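/- **Setting.** Let $\mathcal H_1$ be a complex Hilbert space of finite dimension $N$ (inner products are conjugate linear in the first argument), and let $Z$ be a CAR field over $\mathcal H_1$ acting irreducibly on a finite-dimensional Hilbert space $\mathcal K\neq 0$ (so $\dim\mathcal K=2^N$): $\psi\mapsto Z(\psi)\in\mathcal B(\mathcal K)$ is conjugate linear, $Z(\psi)Z^*(\phi)+Z^*(\phi)Z(\psi)=\langle\psi,\phi\rangle\mathbb 1$ and $Z(\psi)Z(\phi)+Z(\phi)Z(\psi)=0$ for all $\psi,\phi$, where $Z^*(\phi)=Z(\phi)^*$, and only $0$ and $\mathcal K$ are invariant under all $Z(\psi),Z^*(\psi)$. Then $\mathscr A=\mathcal B(\mathcal K)$ is the CAR algebra. On every finite-dimensional space, $\tau$ denotes the trace divided by the dimension, and $F^\dagger$ is the adjoint of a linear map $F$ of operators with respect to $\langle X,Y\rangle=\tau(X^*Y)$. For $0\le Q\le\mathbb 1$ on $\mathcal H_1$ with spectral decomposition $Q=\sum_j\mu_j|\psi_j\rangle\langle\psi_j|$ put $$\rho_Q=\prod_{j=1}^N\bigl(2(1-\mu_j)Z(\psi_j)Z^*(\psi_j)+2\mu_jZ^*(\psi_j)Z(\psi_j)\bigr),$$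 which does not depend on the decomposition. Its GNS inner product is $\langle X,Y\rangle_{\rho_Q}=\tau(X^*Y\rho_Q)$ (possibly degenerate). **The EHK map.** A pair $(S,R)$ of operators on $\mathcal H_1$ is *compatible* if $\|S\|\le1$, $0\le R\le\mathbb 1$ and $R\le\mathbb 1-SS^*$. There is then a unique $T_{S,R}$ with $0\le T_{S,R}\le\mathbb 1$, $\ker(\mathbb 1-SS^*)\subseteq\ker T_{S,R}$ and $R=(\mathbb 1-SS^*)^{1/2}T_{S,R}(\mathbb 1-SS^*)^{1/2}$. Let $W=(-1)^{\mathcal N}$, where $\mathcal N=\sum_jZ^*(e_j)Z(e_j)$ for an orthonormal basis $(e_j)$. Then $Z(\psi\oplus\eta)=Z(\psi)\otimes W+\mathbb 1\otimes Z(\eta)$ is a CAR field over $\mathcal H_1\oplus\mathcal H_1$ acting irreducibly on $\mathcal K\otimes\mathcal K$. Let $\iota_A,\iota_B:\mathscr A\to\mathcal B(\mathcal K\otimes\mathcal K)$ be the $*$-homomorphisms with $\iota_A(Z(\psi))=Z(\psi\oplus0)$ and $\iota_B(Z(\psi))=Z(0\oplus\psi)$. Let $$U_S=\begin{pmatrix}-(\mathbb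 1-SS^*)^{1/2}&S\\S^*&(\mathbb 1-S^*S)^{1/2}\end{pmatrix},$$ let $\alpha_{U_S}$ be the $*$-automorphism of $\mathcal B(\mathcal K\otimes\mathcal K)$ with $\alpha_{U_S}(Z(\xi))=Z(U_S\xi)$, and let $\mathbb E_A$ be the tracial conditional expectation onto $\iota_A(\mathscr A)$, that is, $\mathbb E_A(X)\in\iota_A(\mathscr A)$ and $\tau(B\,\mathbb E_A(X))=\tau(BX)$ for all $B\in\iota_A(\mathscr A)$. The Evans–Hugenholtz–Kadison map $\Phi_{S,R}$ on $\mathscr A$ is $$\Phi_{S,R}(X)=\iota_A^{-1}\Bigl(\mathbb E_A\bigl(\alpha_{U_S}^\dagger(\iota_A(\rho_{T_{S,R}})\,\iota_B(X))\bigr)\Bigr).$$ **Theorem.** Let $T$ and $H$ be operators on $\mathcal H_1$ with $0\le T\le\mathbb 1$, $H\ge0$, $[H,T]=0$ and $\ker H\subseteq\ker T$. Put $S=e^{-H}$, $R=(\mathbb 1-e^{-2H})T$ and $\Phi=\Phi_{S,R}$. 1. $(S,R)$ is a compatible pair, and $T_{S,R}=T$. 2. Let $\{\psi_1,\dots,\psi_N\}$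 be any orthonormal basis of $\mathcal H_1$ with $H\psi_j=\lambda_j\psi_j$ and $T\psi_j=\mu_j\psi_j$ for all $j$, and let $Z_j=Z(\psi_j)$. Put $H_{j,(0,0)}=\mathbb 1$, $H_{j,(1,0)}=Z_j^*$, $H_{j,(0,1)}=Z_j$ and $H_{j,(1,1)}=Z_j^*Z_j-\mu_j\mathbb 1$. For $\boldsymbol\alpha=(\alpha_1,\dots,\alpha_N)\in(\{0,1\}\times\{0,1\})^N$ put $H_{\boldsymbol\alpha}=H_{1,\alpha_1}H_{2,\alpha_2}\cdots H_{N,\alpha_N}$, and write $|(a,b)|=a+b$. Then the operators $H_{\boldsymbol\alpha}$ form a basis of $\mathscr A$, and for every $\boldsymbol\alpha$, $$\Phi^\dagger(H_{\boldsymbol\alpha})=e^{-\sum_{j=1}^N|\alpha_j|\lambda_j}H_{\boldsymbol\alpha}\qquad\text{and}\qquad\Phi(H_{\boldsymbol\alpha}\rho_T)=e^{-\sum_{j=1}^N|\alpha_j|\lambda_j}H_{\boldsymbol\alpha}\rho_T .$$ 3. $\Phi^\dagger$ is self-adjoint with respect to the GNS inner product induced by $\rho_T$: $\langle X,\Phi^\dagger(Y)\rangle_{\rho_T}=\langle\Phi^\dagger(X),Y\rangle_{\rho_T}$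 for all $X,Y\in\mathscr A$. -/

import Mathlib

open scoped TensorProduct

noncomputable section

namespace Fermion

/-! ### CAR fields -/

section Fields

variable {E : Type*} [NormedAddCommGroup E] [InnerProductSpace ℂ E]
variable {K : Type*} [NormedAddCommGroup K] [InnerProductSpace ℂ K] [FiniteDimensional ℂ K]

/-- `Z` is a conjugate linear field of operators on `K` over the one-particle space `E`, satisfying
the canonical anticommutation relations (the relation for two starred fields is the adjoint of
`car_ann`) and acting irreducibly on the nonzero space `K`: no non-trivial subspace is invariant
under all `Z ψ` and all `(Z ψ)*`. -/
structure IsIrreducibleCARField (Z : E →ₗ⋆[ℂ] Module.End ℂ K) : Prop where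
  car : ∀ ψ φ : E, Z ψ * star (Z φ) + star (Z φ) * Z ψ = inner ℂ ψ φ • (1 : Module.End ℂ K)
  car_ann : ∀ ψ φ : E, Z ψ * Z φ + Z φ * Z ψ = 0
  nontrivial : Nontrivial K
  irreducible : ∀ V : Submodule ℂ K,
    (∀ ψ : E, ∀ v ∈ V, Z ψ v ∈ V ∧ star (Z ψ) v ∈ V) → V = ⊥ ∨ V = ⊤

/-- The normalized trace `τ(A) = Tr A / dim K`. -/
def tau (A : Module.End ℂ K) : ℂ :=
  (Module.finrank ℂ K : ℂ)⁻¹ * LinearMap.trace ℂ K A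

/-- The GNS inner product `⟨X, Y⟩ = ρ(X* Y) = τ(X* Y ρ)` of the functional with density matrix `ρ`
(with respect to the normalized trace). -/
def gnsInner (ρ X Y : Module.End ℂ K) : ℂ := tau (star X * Y * ρ)

/-- `Ψ` is the Hilbert-Schmidt adjoint of `Φ`: `τ((Ψ X)* Y) = τ(X* Φ(Y))`. -/
def IsHSAdjoint (Φ Ψ : Module.End ℂ K →ₗ[ℂ] Module.End ℂ K) : Prop :=
  ∀ X Y : Module.End ℂ K, tau (star (Ψ X) * Y) = tau (star X * Φ Y)

open Classical in
/-- The Hilbert-Schmidt adjoint `Φ†` of `Φ`, with respect to `⟨X, Y⟩ = τ(X* Y)`. (It exists and is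
unique; the second branch is never taken.) -/
def hsAdjoint (Φ : Module.End ℂ K →ₗ[ℂ] Module.End ℂ K) :
    Module.End ℂ K →ₗ[ℂ] Module.End ℂ K :=
  if h : ∃ Ψ, IsHSAdjoint Φ Ψ then h.choose else 0

/-- `F` is the tracial conditional expectation onto the `*`-subalgebra `𝒮`: `F(X)` is the unique
element of `𝒮` with `τ(B F(X)) = τ(B X)` for all `B` in `𝒮`. -/
def IsTracialCondExp (𝒮 : StarSubalgebra ℂ (Module.End ℂ K))
    (F : Module.End ℂ K →ₗ[ℂ] Module.End ℂ K) : Prop :=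
  ∀ X : Module.End ℂ K, F X ∈ 𝒮 ∧ ∀ B ∈ 𝒮, tau (B * F X) = tau (B * X)

open Classical in
/-- The tracial conditional expectation onto the `*`-subalgebra `𝒮`. (It exists and is unique; the
second branch is never taken.) -/
def tracialCondExp (𝒮 : StarSubalgebra ℂ (Module.End ℂ K)) :
    Module.End ℂ K →ₗ[ℂ] Module.End ℂ K :=
  if h : ∃ F, IsTracialCondExp 𝒮 F then h.choose else 0

/-- The CAR algebra of a family of field operators: the `*`-algebra generated by all `Z ξ`. -/
def carAlgebra {V : Type*} (Z : V → Module.End ℂ K) : StarSubalgebra ℂ (Module.End ℂ K) :=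
  StarAlgebra.adjoin ℂ (Set.range Z)

open Classical in
/-- Given fields `Z` and `Z'` over the same space, the `*`-homomorphism from the algebra of `Z` that
sends `Z ξ` to `Z' ξ` for every `ξ`. (For CAR fields, with `Z` irreducible, it exists, and it is
unique since `Z` generates all operators.) -/
def carHom {L : Type*} [NormedAddCommGroup L] [InnerProductSpace ℂ L] [FiniteDimensional ℂ L]
    {V : Type*} (Z : V → Module.End ℂ K) (Z' : V → Module.End ℂ L) :
    Module.End ℂ K →ₗ[ℂ] Module.End ℂ L :=
  if h : ∃ f : Module.End ℂ K →⋆ₐ[ℂ] Module.End ℂ L, ∀ ξ, f (Z ξ) = Z' ξ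
  then (h.choose.toAlgHom).toLinearMap else 0

end Fields

section Construction

variable {E : Type*} [NormedAddCommGroup E] [InnerProductSpace ℂ E] [FiniteDimensional ℂ E]
variable {K : Type*} [NormedAddCommGroup K] [InnerProductSpace ℂ K] [FiniteDimensional ℂ K]

/-- The product `∏ⱼ ((1 - μⱼ) 2 Z(ψⱼ) Z*(ψⱼ) + μⱼ 2 Z*(ψⱼ) Z(ψⱼ))`, in increasing order of `j`. -/
def gaussianProduct {N : ℕ} (Z : E → Module.End ℂ K) (ψ : Fin N → E) (μ : Fin N → ℝ) :
    Module.End ℂ K :=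
  (List.ofFn fun j =>
    ((1 - μ j : ℝ) : ℂ) • ((2 : ℂ) • (Z (ψ j) * star (Z (ψ j)))) +
      ((μ j : ℝ) : ℂ) • ((2 : ℂ) • (star (Z (ψ j)) * Z (ψ j)))).prod

/-- The parity operator `W = e^{iπ𝒩} = (-1)^𝒩` of the number operator
`𝒩 = ∑ⱼ Z*(eⱼ) Z(eⱼ)`. Each `Z*(eⱼ) Z(eⱼ)` is a projection, and these commute, so that
`e^{iπ𝒩} = ∏ⱼ (1 - 2 Z*(eⱼ) Z(eⱼ))`. -/
def parity (Z : E → Module.End ℂ K) : Module.End ℂ K :=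
  (List.ofFn fun j => (1 : Module.End ℂ K) -
    (2 : ℂ) • (star (Z (stdOrthonormalBasis ℂ E j)) * Z (stdOrthonormalBasis ℂ E j))).prod

/-- The CAR field `Z(ψ ⊕ η) = Z(ψ) ⊗ W + 1 ⊗ Z(η)` over `E ⊕ E`, acting on `K ⊗ K`. -/
def doubledField (Z : E → Module.End ℂ K) (ξ : WithLp 2 (E × E)) : Module.End ℂ (K ⊗[ℂ] K) :=
  TensorProduct.map (Z ξ.fst) (parity Z) + TensorProduct.map (1 : Module.End ℂ K) (Z ξ.snd)

/-- `A(ψ) = Z(ψ ⊕ 0)`. -/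
def fieldA (Z : E → Module.End ℂ K) (ψ : E) : Module.End ℂ (K ⊗[ℂ] K) :=
  doubledField Z (WithLp.toLp 2 (ψ, 0))

/-- `B(ψ) = Z(0 ⊕ ψ)`. -/
def fieldB (Z : E → Module.End ℂ K) (ψ : E) : Module.End ℂ (K ⊗[ℂ] K) :=
  doubledField Z (WithLp.toLp 2 (0, ψ))

variable [CompleteSpace E]

/-- The density matrix `ρ_Q` (with respect to the normalized trace) of the gauge invariant Gaussian
state with symbol `Q`, through a spectral decomposition of `Q`. -/
def gigDensity (Z : E → Module.End ℂ K) (Q : E →L[ℂ] E) : Module.End ℂ K :=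
  open Classical in
  if h : IsSelfAdjoint Q then
    gaussianProduct Z (h.isSymmetric.eigenvectorBasis rfl) (h.isSymmetric.eigenvalues rfl)
  else 0

/-- Compatible pairs: `S` is a contraction, `0 ≤ R ≤ 1` and `R ≤ 1 - S S*`. -/
def IsCompatiblePair (S R : E →L[ℂ] E) : Prop :=
  ‖S‖ ≤ 1 ∧ 0 ≤ R ∧ R ≤ 1 ∧ R ≤ 1 - S * star S

/-- `T` is the operator associated to `(S, R)`: `0 ≤ T ≤ 1`, `ker (1 - S S*) ⊆ ker T` and
`R = (1 - S S*)^{1/2} T (1 - S S*)^{1/2}`. -/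
def IsAncillaSymbol (S R T : E →L[ℂ] E) : Prop :=
  0 ≤ T ∧ T ≤ 1 ∧ (∀ ψ : E, (1 - S * star S) ψ = 0 → T ψ = 0) ∧
    R = CFC.sqrt (1 - S * star S) * T * CFC.sqrt (1 - S * star S)

open Classical in
/-- The operator `T_{S,R}` associated to the compatible pair `(S, R)`. (It exists and is unique for
every compatible pair.) -/
def ancillaSymbol (S R : E →L[ℂ] E) : E →L[ℂ] E :=
  if h : ∃ T, IsAncillaSymbol S R T then h.choose else 0

/-- The self-adjoint unitary dilation of the contraction `S`, acting on `E ⊕ E`: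
`U_S = [[-(1 - S S*)^{1/2}, S], [S*, (1 - S* S)^{1/2}]]`. -/
def dilation (S : E →L[ℂ] E) (ξ : WithLp 2 (E × E)) : WithLp 2 (E × E) :=
  WithLp.toLp 2
    (-(CFC.sqrt (1 - S * star S) ξ.fst) + S ξ.snd,
      star S ξ.fst + CFC.sqrt (1 - star S * S) ξ.snd)

/-- The automorphism `α_{U_S}` of the algebra over `E ⊕ E`, with `α_{U_S}(Z(ξ)) = Z(U_S ξ)`. -/
def dilationAut (Z : E → Module.End ℂ K) (S : E →L[ℂ] E) :
    Module.End ℂ (K ⊗[ℂ] K) →ₗ[ℂ] Module.End ℂ (K ⊗[ℂ] K) :=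
  carHom (doubledField Z) (fun ξ => doubledField Z (dilation S ξ))

/-- The Evans-Hugenholtz-Kadison map `Φ_{S,R}`. The operator `X` is read in the algebra of `B`, and
`ρ_T`, for `T = T_{S,R}`, in the algebra of `A`; the dual of `α_{U_S}` (whose action on density
matrices is the Hilbert-Schmidt adjoint of `α_{U_S}`) is applied to `ρ_T X`, followed by the tracial
conditional expectation onto the algebra of `A`; the result is read back as an operator on `K`,
through the inverse of the identification `Z(ψ) ↦ A(ψ)`. -/
def ehkMap (Z : E → Module.End ℂ K) (S R : E →L[ℂ] E) :
    Module.End ℂ K →ₗ[ℂ] Module.End ℂ K :=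
  (carHom Z (fieldA Z)).leftInverse ∘ₗ
    tracialCondExp (carAlgebra (fieldA Z)) ∘ₗ
      hsAdjoint (dilationAut Z S) ∘ₗ
        LinearMap.mulLeft ℂ (carHom Z (fieldA Z) (gigDensity Z (ancillaSymbol S R))) ∘ₗ
          carHom Z (fieldB Z)

end Construction

/-! ### Fermionic Hermite operators -/

section Hermite

variable {K : Type*} [NormedAddCommGroup K] [InnerProductSpace ℂ K] [FiniteDimensional ℂ K]

/-- The four operators `1`, `Z*`, `Z`, `Z* Z - μ` for one mode, indexed by
`(0,0)`, `(1,0)`, `(0,1)`, `(1,1)`. -/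
def hermiteOne (z : Module.End ℂ K) (μ : ℝ) : Fin 2 × Fin 2 → Module.End ℂ K
  | (0, 0) => 1
  | (1, 0) => star z
  | (0, 1) => z
  | (1, 1) => star z * z - (μ : ℂ) • (1 : Module.End ℂ K)

/-- The Fermionic Hermite operator `H_α = ∏ⱼ H_{j,αⱼ}`, with the indices increasing from left to
right, for the modes `Zⱼ = Z(ψⱼ)` and the parameters `μⱼ`. -/
def hermite {E : Type*} {N : ℕ} (Z : E → Module.End ℂ K) (ψ : Fin N → E) (μ : Fin N → ℝ)
    (α : Fin N → Fin 2 × Fin 2) : Module.End ℂ K :=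
  (List.ofFn fun j => hermiteOne (Z (ψ j)) (μ j) (α j)).prod

/-- `|(a, b)| = a + b`. -/
def degree (α : Fin 2 × Fin 2) : ℝ := ((α.1 : ℕ) : ℝ) + ((α.2 : ℕ) : ℝ)

end Hermite

end Fermion

end

/-! Diagonalize `H` and `T` in one orthonormal basis and put s_j = e^{-λ_j}, c_j = √(1 - s_j²). The
dilation sends the mode Z(ψ_j ⊕ 0) to s_j 1 ⊗ Z_j - c_j Z_j ⊗ W, and unwinding the definition of Φ
gives τ(Y* Φ(X)) = τ(α(ι_A Y)* (ρ_T ⊗ X)) (`tau_star_mul_ehkMap`). Take Y = H_α. Each factor of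
α(ι_A H_α) is s_j^{|α_j|} 1 ⊗ H_{j,α_j} plus terms whose first leg is a nontrivial one-mode Hermite
operator (`modeOp_dilatedMode`); the centering by μ_j is what makes this true for the number
operator. Such terms average to zero against ρ_T, so only the scaled H_α survives
(`tau_modeProd_dilatedMode`), and H_α is an eigenvector of Φ†.

The averages are computed without expanding ρ_T. Only the exchange relations `IsKMS` between ρ_T and
the fields are used, together with cyclicity of the trace and the parity grading (`tau_field_mul`,
`tau_number_mul`). Those relations mention `T` but no basis, so the eigenbasis chosen in the
definition of ρ_T need not be the one in the statement. They need no division either, so the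
eigenvalues 0 and 1 of `T`, where ρ_T is singular, are not special.

The H_α span by Burnside's theorem and the anticommutation relations. They are independent by a
count: ∏ Z_j* Z_j is a projection of normalized trace 2^{-N}, whence dim K ≥ 2^N
(`two_pow_le_finrank`). The same independence lets the *-homomorphisms in the definition of Φ be
built from a graph (`exists_starAlgHom`).

Distinct H_α are orthogonal for the GNS form (`tau_star_modeProd_mul`), so Φ†, being diagonal with
real eigenvalues, is self-adjoint for it. This self-adjointness is equivalent to Φ(Yρ_T) = Φ†(Y)ρ_T,
which yields the eigenvectors of Φ. -/

noncomputable section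

namespace Fermion

/-! ### Ordered products of commuting or twisted-commuting factors. -/

section Products

theorem commute_prod_ofFn {M : Type*} [Monoid M] {N : ℕ} {f : Fin N → M} {z : M}
    (h : ∀ j, Commute z (f j)) : Commute z (List.ofFn f).prod := by
  refine Commute.list_prod_right _ _ fun x hx => ?_
  obtain ⟨j, rfl⟩ := (List.mem_ofFn' f x).1 hx
  exact h j

/-- A twisted commutation relation of `z` with one factor, when `z` commutes with the others, is
inherited by the product. -/
theorem smul_mul_prod_ofFn {R : Type*} [Ring R] [Algebra ℂ R] {x y : ℂ} {z : R} :
    ∀ {N : ℕ} {f : Fin N → R} (j : Fin N), (∀ k, k ≠ j → Commute z (f k)) →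
      x • (z * f j) = y • (f j * z) →
      x • (z * (List.ofFn f).prod) = y • ((List.ofFn f).prod * z)
  | 0, _, j, _, _ => j.elim0
  | N + 1, f, j, hc, hj => by
    rw [List.ofFn_succ, List.prod_cons]
    refine Fin.cases (fun hc hj => ?_) (fun j hc hj => ?_) j hc hj
    · have := commute_prod_ofFn (z := z) (f := fun i : Fin N => f i.succ)
        fun i => hc _ (Fin.succ_ne_zero i)
      rw [← mul_assoc, ← smul_mul_assoc, hj, smul_mul_assoc, mul_assoc, this.eq, ← mul_assoc]
    · have h0 := hc 0 (Fin.succ_ne_zero j).symm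
      have := smul_mul_prod_ofFn (x := x) (y := y) (z := z) (f := fun i : Fin N => f i.succ) j
        (fun k hk => hc _ (by simpa using hk)) hj
      rw [← mul_assoc, h0.eq, mul_assoc, ← mul_smul_comm, this, mul_smul_comm, mul_assoc]

theorem star_prod_ofFn {R : Type*} [Monoid R] [StarMul R] :
    ∀ {N : ℕ} {f : Fin N → R}, (∀ j, star (f j) = f j) → (∀ j k, Commute (f j) (f k)) →
      star (List.ofFn f).prod = (List.ofFn f).prod
  | 0, _, _, _ => by simp
  | N + 1, f, hs, hc => by
    rw [List.ofFn_succ, List.prod_cons, star_mul,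
      star_prod_ofFn (f := fun i : Fin N => f i.succ) (fun j => hs _) (fun j k => hc _ _), hs]
    exact (commute_prod_ofFn fun i => hc 0 i.succ).eq.symm

theorem prod_ofFn_mul_self {R : Type*} [Monoid R] :
    ∀ {N : ℕ} {f g : Fin N → R}, (∀ j, f j * f j = g j) → (∀ j k, Commute (f j) (f k)) →
      (List.ofFn f).prod * (List.ofFn f).prod = (List.ofFn g).prod
  | 0, _, _, _, _ => by simp
  | N + 1, f, g, hs, hc => by
    rw [List.ofFn_succ, List.ofFn_succ, List.prod_cons, List.prod_cons,
      ← prod_ofFn_mul_self (f := fun i : Fin N => f i.succ) (fun j => hs j.succ)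
        (fun j k => hc _ _), ← hs]
    have := (commute_prod_ofFn fun i : Fin N => hc 0 i.succ).eq
    simp only [mul_assoc]
    rw [← mul_assoc _ (f 0), ← this, mul_assoc]

theorem prod_ofFn_mem {R : Type*} [Ring R] [Algebra ℂ R] (C : Subalgebra ℂ R) {N : ℕ}
    {f : Fin N → R} (h : ∀ j, f j ∈ C) : (List.ofFn f).prod ∈ C := by
  refine C.list_prod_mem fun x hx => ?_
  obtain ⟨j, rfl⟩ := (List.mem_ofFn' f x).1 hx
  exact h j

end Products

/-! ### Consequences of the anticommutation relations, and the parity operator. -/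

section CAR

variable {E : Type*} [NormedAddCommGroup E] [InnerProductSpace ℂ E]
variable {K : Type*} [NormedAddCommGroup K] [InnerProductSpace ℂ K] [FiniteDimensional ℂ K]

/-- The canonical anticommutation relations, without irreducibility. -/
structure IsCAR (Z : E →ₗ⋆[ℂ] Module.End ℂ K) : Prop where
  car : ∀ ψ φ : E, Z ψ * star (Z φ) + star (Z φ) * Z ψ = inner ℂ ψ φ • (1 : Module.End ℂ K)
  car_ann : ∀ ψ φ : E, Z ψ * Z φ + Z φ * Z ψ = 0

theorem IsIrreducibleCARField.isCAR {Z : E →ₗ⋆[ℂ] Module.End ℂ K}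
    (hZ : IsIrreducibleCARField Z) : IsCAR Z := ⟨hZ.car, hZ.car_ann⟩

namespace IsCAR

variable {Z : E →ₗ⋆[ℂ] Module.End ℂ K} (hZ : IsCAR Z)
include hZ

theorem mul_comm_neg (ψ φ : E) : Z ψ * Z φ = -(Z φ * Z ψ) :=
  eq_neg_of_add_eq_zero_left (hZ.car_ann ψ φ)

theorem star_mul_comm_neg (ψ φ : E) : star (Z ψ) * star (Z φ) = -(star (Z φ) * star (Z ψ)) := by
  rw [← star_mul, hZ.mul_comm_neg, star_neg, star_mul]

theorem mul_star_comm_neg {ψ φ : E} (h : inner ℂ ψ φ = 0) :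
    Z ψ * star (Z φ) = -(star (Z φ) * Z ψ) :=
  eq_neg_of_add_eq_zero_left (by rw [hZ.car, h, zero_smul])

theorem star_mul_comm_neg' {ψ φ : E} (h : inner ℂ ψ φ = 0) :
    star (Z ψ) * Z φ = -(Z φ * star (Z ψ)) := by
  rw [hZ.mul_star_comm_neg (inner_eq_zero_symm.1 h), neg_neg]

theorem mul_self (ψ : E) : Z ψ * Z ψ = 0 := by
  have h := hZ.car_ann ψ ψ
  rw [← two_smul ℂ] at h
  exact (smul_eq_zero.1 h).resolve_left two_ne_zero

theorem star_mul_self (ψ : E) : star (Z ψ) * star (Z ψ) = 0 := by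
  rw [← star_mul, hZ.mul_self, star_zero]

theorem car_unit {ψ : E} (h : ‖ψ‖ = 1) : Z ψ * star (Z ψ) = 1 - star (Z ψ) * Z ψ := by
  rw [eq_sub_iff_add_eq, hZ.car, inner_self_eq_norm_sq_to_K, h]
  simp

theorem commute_number {φ ψ : E} (h : inner ℂ φ ψ = 0) :
    Commute (Z φ) (star (Z ψ) * Z ψ) := by
  rw [Commute, SemiconjBy, ← mul_assoc, hZ.mul_star_comm_neg h, neg_mul, mul_assoc,
    hZ.mul_comm_neg φ ψ, mul_neg, neg_neg, mul_assoc]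

theorem star_commute_number {φ ψ : E} (h : inner ℂ φ ψ = 0) :
    Commute (star (Z φ)) (star (Z ψ) * Z ψ) := by
  have := (hZ.commute_number h).star_star
  rwa [star_mul, star_star] at this

theorem number_mul_number {ψ : E} (h : ‖ψ‖ = 1) :
    star (Z ψ) * Z ψ * (star (Z ψ) * Z ψ) = star (Z ψ) * Z ψ := by
  rw [mul_assoc, ← mul_assoc (Z ψ), hZ.car_unit h, sub_mul, one_mul, mul_assoc, hZ.mul_self,
    mul_zero, sub_zero]

theorem mul_number {ψ : E} (h : ‖ψ‖ = 1) : Z ψ * (star (Z ψ) * Z ψ) = Z ψ := by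
  rw [← mul_assoc, hZ.car_unit h, sub_mul, one_mul, mul_assoc, hZ.mul_self, mul_zero, sub_zero]

theorem number_mul (ψ : E) : star (Z ψ) * Z ψ * Z ψ = 0 := by
  rw [mul_assoc, hZ.mul_self, mul_zero]

theorem star_mul_number (ψ : E) : star (Z ψ) * (star (Z ψ) * Z ψ) = 0 := by
  rw [← mul_assoc, hZ.star_mul_self, zero_mul]

theorem number_mul_star {ψ : E} (h : ‖ψ‖ = 1) :
    star (Z ψ) * Z ψ * star (Z ψ) = star (Z ψ) := by
  rw [mul_assoc, hZ.car_unit h, mul_sub, mul_one, ← mul_assoc, hZ.star_mul_self, zero_mul,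
    sub_zero]

end IsCAR

/-- The even factor `a + b Z*(ψ) Z(ψ)`. -/
def evenFactor (Z : E → Module.End ℂ K) (ψ : E) (a b : ℝ) : Module.End ℂ K :=
  (a : ℂ) • (1 : Module.End ℂ K) + (b : ℂ) • (star (Z ψ) * Z ψ)

omit [NormedAddCommGroup E] [InnerProductSpace ℂ E] in
theorem star_evenFactor (Z : E → Module.End ℂ K) (ψ : E) (a b : ℝ) :
    star (evenFactor Z ψ a b) = evenFactor Z ψ a b := by
  simp [evenFactor]

namespace IsCAR

variable {Z : E →ₗ⋆[ℂ] Module.End ℂ K} (hZ : IsCAR Z)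
include hZ

theorem commute_evenFactor {φ ψ : E} (h : inner ℂ φ ψ = 0) (a b : ℝ) :
    Commute (Z φ) (evenFactor Z ψ a b) :=
  ((Commute.one_right _).smul_right _).add_right ((hZ.commute_number h).smul_right _)

theorem star_commute_evenFactor {φ ψ : E} (h : inner ℂ φ ψ = 0) (a b : ℝ) :
    Commute (star (Z φ)) (evenFactor Z ψ a b) :=
  ((Commute.one_right _).smul_right _).add_right ((hZ.star_commute_number h).smul_right _)

theorem evenFactor_commute_evenFactor {φ ψ : E} (h : inner ℂ φ ψ = 0) (a b a' b' : ℝ) :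
    Commute (evenFactor Z φ a b) (evenFactor Z ψ a' b') :=
  ((Commute.one_left _).smul_left _).add_left
    (((hZ.star_commute_evenFactor h _ _).mul_left (hZ.commute_evenFactor h _ _)).smul_left _)

variable {N : ℕ} {v : Fin N → E} (hv : Orthonormal ℂ v)
include hv

theorem evenFactor_commute (a b : Fin N → ℝ) (j k : Fin N) :
    Commute (evenFactor Z (v j) (a j) (b j)) (evenFactor Z (v k) (a k) (b k)) := by
  rcases eq_or_ne j k with rfl | h
  · exact Commute.refl _
  · exact hZ.evenFactor_commute_evenFactor (hv.2 h) _ _ _ _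

/-- Since Z Z*Z = Z and Z*Z Z = 0, the factor a + b Z*Z acts as a + b when it stands to the right of
Z and as a when it stands to the left. The ratio is kept as two scalars so that either value may
vanish. The parity operator and the Gaussian densities are both treated as such products. -/
theorem smul_mul_evenProd {a b : Fin N → ℝ} {x y : ℂ} (j : Fin N)
    (h : x * (a j + b j) = y * a j) :
    x • (Z (v j) * (List.ofFn fun j => evenFactor Z (v j) (a j) (b j)).prod) =
      y • ((List.ofFn fun j => evenFactor Z (v j) (a j) (b j)).prod * Z (v j)) := by
  refine smul_mul_prod_ofFn j (fun k hk => hZ.commute_evenFactor (hv.2 hk.symm) _ _) ?_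
  simp only [evenFactor, mul_add, add_mul, mul_smul_comm, smul_mul_assoc, mul_one, one_mul,
    hZ.mul_number (hv.1 j), hZ.number_mul, smul_zero, add_zero, smul_smul, ← add_smul]
  rw [← h, mul_add]

theorem smul_star_mul_evenProd {a b : Fin N → ℝ} {x y : ℂ} (j : Fin N)
    (h : x * a j = y * (a j + b j)) :
    x • (star (Z (v j)) * (List.ofFn fun j => evenFactor Z (v j) (a j) (b j)).prod) =
      y • ((List.ofFn fun j => evenFactor Z (v j) (a j) (b j)).prod * star (Z (v j))) := by
  refine smul_mul_prod_ofFn j (fun k hk => hZ.star_commute_evenFactor (hv.2 hk.symm) _ _) ?_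
  simp only [evenFactor, mul_add, add_mul, mul_smul_comm, smul_mul_assoc, mul_one, one_mul,
    hZ.number_mul_star (hv.1 j), hZ.star_mul_number, smul_zero, add_zero, smul_smul, ← add_smul]
  rw [h, mul_add]

end IsCAR

section Parity

variable [FiniteDimensional ℂ E] {Z : E →ₗ⋆[ℂ] Module.End ℂ K} (hZ : IsCAR Z)

theorem parity_eq (Z : E → Module.End ℂ K) : parity Z =
    (List.ofFn fun j => evenFactor Z (stdOrthonormalBasis ℂ E j) 1 (-2)).prod := by
  simp [parity, evenFactor, sub_eq_add_neg]

include hZ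

theorem IsCAR.star_parity : star (parity Z) = parity Z := by
  rw [parity_eq]
  exact star_prod_ofFn (fun j => star_evenFactor _ _ _ _)
    (hZ.evenFactor_commute (stdOrthonormalBasis ℂ E).orthonormal _ _)

theorem IsCAR.parity_mul_parity : parity Z * parity Z = 1 := by
  rw [parity_eq, prod_ofFn_mul_self (g := fun _ => 1) (fun j => ?_)
    (hZ.evenFactor_commute (stdOrthonormalBasis ℂ E).orthonormal _ _)]
  · simp
  · have := hZ.number_mul_number ((stdOrthonormalBasis ℂ E).orthonormal.1 j)
    simp only [evenFactor, mul_add, add_mul, mul_smul_comm, smul_mul_assoc, mul_one, one_mul, this]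
    push_cast
    module

theorem IsCAR.mul_parity (ψ : E) : Z ψ * parity Z = -(parity Z * Z ψ) := by
  have key : ∀ j, Z (stdOrthonormalBasis ℂ E j) * parity Z =
      -(parity Z * Z (stdOrthonormalBasis ℂ E j)) := fun j => by
    have := hZ.smul_mul_evenProd (stdOrthonormalBasis ℂ E).orthonormal (a := fun _ => 1)
      (b := fun _ => -2) (x := 1) (y := -1) j (by norm_num)
    simpa [parity_eq] using this
  rw [← (stdOrthonormalBasis ℂ E).sum_repr' ψ]
  simp only [map_sum, map_smulₛₗ, Finset.sum_mul, Finset.mul_sum, smul_mul_assoc, mul_smul_comm,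
    key, smul_neg, Finset.sum_neg_distrib]

theorem IsCAR.star_mul_parity (ψ : E) : star (Z ψ) * parity Z = -(parity Z * star (Z ψ)) := by
  have := congrArg star (hZ.mul_parity ψ)
  rw [star_neg, star_mul, star_mul, hZ.star_parity] at this
  rw [this, neg_neg]

end Parity

end CAR

/-! ### Families satisfying the canonical anticommutation relations -/

section Families

variable {R : Type*} [Ring R] [StarRing R] [Algebra ℂ R]

/-- Finitely many modes satisfying the canonical anticommutation relations, in a `*`-algebra. -/
structure IsCARFamily {N : ℕ} (z : Fin N → R) : Prop where
  ann : ∀ j k, z j * z k + z k * z j = 0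
  car : ∀ j k, z j * star (z k) + star (z k) * z j = if j = k then 1 else 0

/-- The operators `1`, `z*`, `z`, `z* z - μ` of one mode, in an arbitrary `*`-algebra. -/
def modeOp (z : R) (μ : ℝ) : Fin 2 × Fin 2 → R
  | (0, 0) => 1
  | (1, 0) => star z
  | (0, 1) => z
  | (1, 1) => star z * z - (μ : ℂ) • (1 : R)

/-- The product of the operators `modeOp`, in increasing order of the modes. -/
def modeProd {N : ℕ} (z : Fin N → R) (μ : Fin N → ℝ) (α : Fin N → Fin 2 × Fin 2) : R :=
  (List.ofFn fun j => modeOp (z j) (μ j) (α j)).prod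

theorem modeProd_succ {N : ℕ} (z : Fin (N + 1) → R) (μ : Fin (N + 1) → ℝ)
    (α : Fin (N + 1) → Fin 2 × Fin 2) : modeProd z μ α = modeOp (z 0) (μ 0) (α 0) *
      modeProd (fun j => z j.succ) (fun j => μ j.succ) fun j => α j.succ := by
  simp [modeProd, List.ofFn_succ]

theorem modeProd_zero {N : ℕ} (z : Fin N → R) (μ : Fin N → ℝ) :
    modeProd z μ (fun _ => (0, 0)) = 1 := by
  simp [modeProd, modeOp]

theorem map_modeOp {R' : Type*} [Ring R'] [StarRing R'] [Algebra ℂ R'] (f : R →⋆ₐ[ℂ] R') (z : R)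
    (μ : ℝ) (a : Fin 2 × Fin 2) : f (modeOp z μ a) = modeOp (f z) μ a := by
  fin_cases a <;> simp [modeOp, -Complex.coe_smul, map_star]

/-- Naturality is the reason for working in arbitrary *-algebras: it is applied to a coordinate
projection of a product algebra and to the embedding ι_A followed by the dilation automorphism. -/
theorem map_modeProd {R' : Type*} [Ring R'] [StarRing R'] [Algebra ℂ R'] (f : R →⋆ₐ[ℂ] R')
    {N : ℕ} (z : Fin N → R) (μ : Fin N → ℝ) (α : Fin N → Fin 2 × Fin 2) :
    f (modeProd z μ α) = modeProd (fun j => f (z j)) μ α := by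
  rw [modeProd, map_list_prod, List.map_ofFn, modeProd]
  congr 2
  funext j
  exact map_modeOp f _ _ _

omit [Algebra ℂ R] in
theorem IsCARFamily.succ {N : ℕ} {z : Fin (N + 1) → R} (hz : IsCARFamily z) :
    IsCARFamily fun j : Fin N => z j.succ :=
  ⟨fun j k => hz.ann _ _, fun j k => by simpa using hz.car j.succ k.succ⟩

theorem modeOp_mem (C : Subalgebra ℂ R) {z : R} (h : z ∈ C) (h' : star z ∈ C) (μ : ℝ)
    (a : Fin 2 × Fin 2) : modeOp z μ a ∈ C := by
  fin_cases a
  · exact C.one_mem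
  · exact h
  · exact h'
  · exact C.sub_mem (C.mul_mem h' h) (C.smul_mem C.one_mem _)

theorem modeProd_mem (C : Subalgebra ℂ R) {N : ℕ} {z : Fin N → R} (h : ∀ j, z j ∈ C)
    (h' : ∀ j, star (z j) ∈ C) (μ : Fin N → ℝ) (α : Fin N → Fin 2 × Fin 2) :
    modeProd z μ α ∈ C :=
  prod_ofFn_mem C fun j => modeOp_mem C (h j) (h' j) _ _

/-- An operator anticommuting with `z` and `z*` commutes with `modeOp z` up to a sign. -/
theorem mul_modeOp_of_anticomm {z y : R} (h : y * z = -(z * y)) (h' : y * star z = -(star z * y))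
    (μ : ℝ) (a : Fin 2 × Fin 2) :
    ∃ e : ℂ, y * modeOp z μ a = e • (modeOp z μ a * y) := by
  fin_cases a
  · exact ⟨1, by simp [modeOp]⟩
  · exact ⟨-1, by simp [modeOp, h]⟩
  · exact ⟨-1, by simp [modeOp, h']⟩
  · refine ⟨1, ?_⟩
    simp [modeOp, mul_sub, sub_mul, ← mul_assoc, h']
    simp [mul_assoc, h]

theorem mul_modeOp_mem_span {z : R} (h : z * z = 0) (h' : z * star z = 1 - star z * z) (μ : ℝ)
    (a : Fin 2 × Fin 2) :
    z * modeOp z μ a ∈ Submodule.span ℂ (Set.range (modeOp z μ)) ∧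
      star z * modeOp z μ a ∈ Submodule.span ℂ (Set.range (modeOp z μ)) := by
  set V := Submodule.span ℂ (Set.range (modeOp z μ))
  have hm : ∀ b, modeOp z μ b ∈ V := fun b => Submodule.subset_span ⟨b, rfl⟩
  have h00 : (1 : R) ∈ V := hm (0, 0)
  have h10 : star z ∈ V := hm (1, 0)
  have h01 : z ∈ V := hm (0, 1)
  have h11 : star z * z ∈ V := by
    have : star z * z = modeOp z μ (1, 1) + (μ : ℂ) • (1 : R) := by simp [modeOp]
    rw [this]
    exact V.add_mem (hm _) (V.smul_mem _ h00)
  have hs : star z * star z = 0 := by rw [← star_mul, h, star_zero]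
  fin_cases a
  · simpa [modeOp] using ⟨h01, h10⟩
  · simpa [modeOp, h] using h11
  · simp only [modeOp, hs, h']
    exact ⟨V.sub_mem h00 h11, V.zero_mem⟩
  · simp only [modeOp, mul_sub, ← mul_assoc, hs, h', zero_mul, zero_sub, mul_smul_comm, mul_one,
      sub_mul, one_mul]
    rw [mul_assoc, h, mul_zero, sub_zero]
    exact ⟨V.sub_mem h01 (V.smul_mem _ h01), V.neg_mem (V.smul_mem _ h10)⟩

/-- The span is a left ideal for the generators. Mode 0 is absorbed into the leading factor, because
the four one-mode operators span a space stable under it; any other mode passes the leading factor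
at the cost of a scalar and is handled by induction. -/
theorem mul_mem_span_modeProd : ∀ {N : ℕ} {z : Fin N → R} (_ : IsCARFamily z) (μ : Fin N → ℝ)
    (j : Fin N) (x : R), x ∈ Submodule.span ℂ (Set.range (modeProd z μ)) →
      z j * x ∈ Submodule.span ℂ (Set.range (modeProd z μ)) ∧
        star (z j) * x ∈ Submodule.span ℂ (Set.range (modeProd z μ))
  | 0, _, _, _, j, _, _ => j.elim0
  | N + 1, z, hz, μ, j, x, hx => by
    set V := Submodule.span ℂ (Set.range (modeProd z μ))
    set V' := Submodule.span ℂ (Set.range (modeProd (fun j => z j.succ) fun j => μ j.succ))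
    have hh : ∀ y ∈ Submodule.span ℂ (Set.range (modeOp (z 0) (μ 0))), ∀ t ∈ V', y * t ∈ V := by
      intro y hy t ht
      have := Submodule.mul_mem_mul hy ht
      rw [Submodule.span_mul_span] at this
      refine Submodule.span_mono ?_ this
      rintro _ ⟨_, ⟨a, rfl⟩, _, ⟨β, rfl⟩, rfl⟩
      exact ⟨Fin.cons a β, by simp [modeProd_succ]⟩
    induction hx using Submodule.span_induction with
    | zero => simp
    | add x y _ _ hx hy =>
      rw [mul_add, mul_add]
      exact ⟨V.add_mem hx.1 hy.1, V.add_mem hx.2 hy.2⟩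
    | smul c x _ hx =>
      rw [mul_smul_comm, mul_smul_comm]
      exact ⟨V.smul_mem _ hx.1, V.smul_mem _ hx.2⟩
    | mem x hx =>
      obtain ⟨α, rfl⟩ := hx
      rw [modeProd_succ, ← mul_assoc, ← mul_assoc]
      have ht : modeProd (fun j => z j.succ) (fun j => μ j.succ) (fun j => α j.succ) ∈ V' :=
        Submodule.subset_span ⟨_, rfl⟩
      refine Fin.cases ?_ (fun j => ?_) j
      · have h2 : z 0 * z 0 = 0 := by
          have h := hz.ann 0 0
          rw [← two_smul ℂ] at h
          exact (smul_eq_zero.1 h).resolve_left two_ne_zero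
        have h3 : z 0 * star (z 0) = 1 - star (z 0) * z 0 := by
          rw [eq_sub_iff_add_eq, hz.car, if_pos rfl]
        have := mul_modeOp_mem_span h2 h3 (μ 0) (α 0)
        exact ⟨hh _ this.1 _ ht, hh _ this.2 _ ht⟩
      · have ih := mul_mem_span_modeProd hz.succ (fun j => μ j.succ) j _ ht
        have c1 : z j.succ * star (z 0) = -(star (z 0) * z j.succ) :=
          eq_neg_of_add_eq_zero_left (by rw [hz.car, if_neg (Fin.succ_ne_zero j)])
        have c2 : z 0 * star (z j.succ) = -(star (z j.succ) * z 0) :=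
          eq_neg_of_add_eq_zero_left (by rw [hz.car, if_neg (Fin.succ_ne_zero j).symm])
        have c3 := eq_neg_of_add_eq_zero_left (hz.ann j.succ 0)
        have c4 : star (z j.succ) * star (z 0) = -(star (z 0) * star (z j.succ)) := by
          rw [← star_mul, ← star_mul, ← star_neg, c3, neg_neg]
        obtain ⟨e, he⟩ := mul_modeOp_of_anticomm c3 c1 (μ 0) (α 0)
        obtain ⟨e', he'⟩ := mul_modeOp_of_anticomm (by rw [c2, neg_neg]) c4 (μ 0) (α 0)
        have h0 : modeOp (z 0) (μ 0) (α 0) ∈ Submodule.span ℂ (Set.range (modeOp (z 0) (μ 0))) :=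
          Submodule.subset_span ⟨_, rfl⟩
        rw [he, he', smul_mul_assoc, smul_mul_assoc, mul_assoc, mul_assoc]
        exact ⟨V.smul_mem _ (hh _ h0 _ ih.1), V.smul_mem _ (hh _ h0 _ ih.2)⟩

variable [StarModule ℂ R]

/-- The `*`-algebra generated by a field is spanned by the products `modeProd`. -/
theorem adjoin_le_span_modeProd {E : Type*} [NormedAddCommGroup E] [InnerProductSpace ℂ E] {N : ℕ}
    (ψ : OrthonormalBasis (Fin N) ℂ E) (Z : E →ₗ⋆[ℂ] R) (hz : IsCARFamily fun j => Z (ψ j))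
    (μ : Fin N → ℝ) {x : R} (hx : x ∈ StarAlgebra.adjoin ℂ (Set.range Z)) :
    x ∈ Submodule.span ℂ (Set.range (modeProd (fun j => Z (ψ j)) μ)) := by
  set V := Submodule.span ℂ (Set.range (modeProd (fun j => Z (ψ j)) μ))
  have hZ : ∀ φ : E, ∀ y ∈ V, Z φ * y ∈ V ∧ star (Z φ) * y ∈ V := by
    intro φ y hy
    rw [← ψ.sum_repr' φ]
    simp only [map_sum, map_smulₛₗ, Finset.sum_mul, smul_mul_assoc, star_sum, star_smul]
    exact ⟨V.sum_mem fun j _ => V.smul_mem _ (mul_mem_span_modeProd hz μ j y hy).1,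
      V.sum_mem fun j _ => V.smul_mem _ (mul_mem_span_modeProd hz μ j y hy).2⟩
  -- Stability under left multiplication passes from the generators to the algebra; it is then
  -- applied to the unit, which lies in the span.
  have key : ∀ y ∈ V, x * y ∈ V := by
    rw [← StarSubalgebra.mem_toSubalgebra, StarAlgebra.adjoin_toSubalgebra] at hx
    induction hx using Algebra.adjoin_induction with
    | mem x hx =>
      intro y hy
      rcases hx with ⟨φ, rfl⟩ | ⟨φ, hφ⟩
      · exact (hZ φ y hy).1
      · rw [← star_star x, ← hφ]
        exact (hZ φ y hy).2
    | algebraMap c =>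
      intro y hy
      rw [← Algebra.smul_def]
      exact V.smul_mem _ hy
    | add x x' _ _ hx hx' =>
      intro y hy
      rw [add_mul]
      exact V.add_mem (hx y hy) (hx' y hy)
    | mul x x' _ _ hx hx' =>
      intro y hy
      rw [mul_assoc]
      exact hx _ (hx' y hy)
  have h1 : (1 : R) ∈ V := Submodule.subset_span ⟨fun _ => (0, 0), modeProd_zero _ _⟩
  simpa using key 1 h1

end Families

/-! ### Irreducibility and the span of the Hermite operators. -/

section Span

variable {E : Type*} [NormedAddCommGroup E] [InnerProductSpace ℂ E]
variable {K : Type*} [NormedAddCommGroup K] [InnerProductSpace ℂ K] [FiniteDimensional ℂ K]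

theorem hermiteOne_eq_modeOp (z : Module.End ℂ K) (μ : ℝ) (a : Fin 2 × Fin 2) :
    hermiteOne z μ a = modeOp z μ a := by
  fin_cases a <;> rfl

omit [NormedAddCommGroup E] [InnerProductSpace ℂ E] in
theorem hermite_eq_modeProd {N : ℕ} (Z : E → Module.End ℂ K) (ψ : Fin N → E) (μ : Fin N → ℝ)
    (α : Fin N → Fin 2 × Fin 2) : hermite Z ψ μ α = modeProd (fun j => Z (ψ j)) μ α := by
  simp only [hermite, modeProd, hermiteOne_eq_modeOp]

theorem IsCAR.isCARFamily {Z : E →ₗ⋆[ℂ] Module.End ℂ K} (hZ : IsCAR Z) {N : ℕ} {v : Fin N → E}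
    (hv : Orthonormal ℂ v) : IsCARFamily fun j => Z (v j) := by
  refine ⟨fun j k => hZ.car_ann _ _, fun j k => ?_⟩
  rw [hZ.car, orthonormal_iff_ite.1 hv]
  split_ifs <;> simp

theorem span_modeProd_eq_top {Z : E →ₗ⋆[ℂ] Module.End ℂ K} (hZ : IsCAR Z)
    (htop : carAlgebra Z = ⊤) {N : ℕ} (ψ : OrthonormalBasis (Fin N) ℂ E) (μ : Fin N → ℝ) :
    Submodule.span ℂ (Set.range (modeProd (fun j => Z (ψ j)) μ)) = ⊤ := by
  refine Submodule.eq_top_iff'.2 fun x => ?_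
  refine adjoin_le_span_modeProd ψ Z (hZ.isCARFamily ψ.orthonormal) μ ?_
  change x ∈ carAlgebra Z
  rw [htop]
  exact trivial

/-- Burnside's theorem for an irreducible CAR field. -/
theorem IsIrreducibleCARField.carAlgebra_eq_top {Z : E →ₗ⋆[ℂ] Module.End ℂ K}
    (hZ : IsIrreducibleCARField Z) : carAlgebra Z = ⊤ := by
  classical
  have := hZ.nontrivial
  let A := (carAlgebra Z).toSubalgebra
  have hA : ∀ ψ, Z ψ ∈ A := fun ψ => StarAlgebra.subset_adjoin ℂ _ ⟨ψ, rfl⟩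
  have hA' : ∀ ψ, star (Z ψ) ∈ A := fun ψ => star_mem (S := StarSubalgebra ℂ (Module.End ℂ K))
    (s := carAlgebra Z) (hA ψ)
  have hsimple : IsSimpleModule A K := by
    rw [isSimpleModule_iff]
    refine { eq_bot_or_eq_top := fun V => ?_ }
    rcases hZ.irreducible (V.restrictScalars ℂ) fun ψ v hv =>
      ⟨V.smul_mem (⟨_, hA ψ⟩ : A) hv, V.smul_mem (⟨_, hA' ψ⟩ : A) hv⟩ with h | h
    · exact Or.inl (by simpa using h)
    · exact Or.inr (by simpa using h)
  refine eq_top_iff.2 fun X _ => ?_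
  -- Schur's lemma over ℂ: the commutant is scalar, so every operator is linear over it. The density
  -- theorem, tested on a basis of `K`, then realizes the operator inside the algebra.
  have hsmul : ∀ g : Module.End A K, ∃ c : ℂ, ∀ v, g v = c • v := fun g => by
    obtain ⟨c, hc⟩ := (IsSimpleModule.algebraMap_end_bijective_of_isAlgClosed ℂ (A := A)
      (V := K)).2 g
    exact ⟨c, fun v => by rw [← hc]; rfl⟩
  let F : Module.End (Module.End A K) K :=
    { toFun := X
      map_add' := X.map_add
      map_smul' := fun g v => by
        obtain ⟨c, hc⟩ := hsmul g
        simp [hc] }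
  obtain ⟨r, hr⟩ := jacobson_density F (Finset.univ.image (Module.finBasis ℂ K))
  have : X = r.1 := (Module.finBasis ℂ K).ext fun i => hr _ (by simp)
  rw [this]
  exact r.2

end Span

/-! ### The normalized trace and its faithfulness. -/

section Tau

variable {K : Type*} [NormedAddCommGroup K] [InnerProductSpace ℂ K]

theorem tau_add (x y : Module.End ℂ K) : tau (x + y) = tau x + tau y := by
  simp [tau, mul_add]

theorem tau_sub (x y : Module.End ℂ K) : tau (x - y) = tau x - tau y := by
  simp [tau, mul_sub]

theorem tau_neg (x : Module.End ℂ K) : tau (-x) = -tau x := by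
  simp [tau]

theorem tau_smul (c : ℂ) (x : Module.End ℂ K) : tau (c • x) = c * tau x := by
  simp [tau, mul_left_comm]

theorem tau_zero : tau (0 : Module.End ℂ K) = 0 := by
  simp [tau]

theorem tau_mul_comm (x y : Module.End ℂ K) : tau (x * y) = tau (y * x) := by
  rw [tau, tau, LinearMap.trace_mul_comm]

variable [FiniteDimensional ℂ K]

theorem tau_one [Nontrivial K] : tau (1 : Module.End ℂ K) = 1 := by
  rw [tau, LinearMap.trace_one]
  exact inv_mul_cancel₀ (Nat.cast_ne_zero.2 Module.finrank_pos.ne')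

theorem tau_star (x : Module.End ℂ K) : tau (star x) = star (tau x) := by
  rw [tau, tau, LinearMap.trace_eq_sum_inner _ (stdOrthonormalBasis ℂ K),
    LinearMap.trace_eq_sum_inner x (stdOrthonormalBasis ℂ K), star_mul', star_sum]
  congr 1
  · simp
  · refine Finset.sum_congr rfl fun i _ => ?_
    rw [LinearMap.star_eq_adjoint, LinearMap.adjoint_inner_right]
    exact (inner_conj_symm _ _).symm

/-- In an orthonormal basis τ(x* x) is the sum of the ‖x e_i‖² over the dimension. This faithfulness
turns identities of pairings into identities of operators. -/
theorem eq_zero_of_tau_star_mul_self {x : Module.End ℂ K} (h : tau (star x * x) = 0) : x = 0 := by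
  rcases subsingleton_or_nontrivial K with hK | hK
  · exact Subsingleton.elim _ _
  have hd : (Module.finrank ℂ K : ℂ)⁻¹ ≠ 0 :=
    inv_ne_zero (Nat.cast_ne_zero.2 Module.finrank_pos.ne')
  have h2 := (mul_eq_zero.1 h).resolve_left hd
  rw [LinearMap.trace_eq_sum_inner _ (stdOrthonormalBasis ℂ K)] at h2
  have h3 : ∑ i, ‖x (stdOrthonormalBasis ℂ K i)‖ ^ 2 = 0 := by
    have : ((∑ i, ‖x (stdOrthonormalBasis ℂ K i)‖ ^ 2 : ℝ) : ℂ) = 0 := by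
      rw [← h2]
      push_cast
      refine Finset.sum_congr rfl fun i _ => ?_
      rw [Module.End.mul_apply, LinearMap.star_eq_adjoint, LinearMap.adjoint_inner_right,
        inner_self_eq_norm_sq_to_K]
      rfl
    exact_mod_cast this
  rw [Finset.sum_eq_zero_iff_of_nonneg fun i _ => by positivity] at h3
  refine (stdOrthonormalBasis ℂ K).toBasis.ext fun i => ?_
  simpa using h3 i (Finset.mem_univ i)

theorem eq_of_tau_mul_eq {x y : Module.End ℂ K} (h : ∀ z, tau (z * x) = tau (z * y)) : x = y := by
  refine sub_eq_zero.1 (eq_zero_of_tau_star_mul_self ?_)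
  rw [mul_sub, tau_sub, h, sub_self]

end Tau

/-! ### Density matrices satisfying the KMS relations -/

section KMS

variable {E : Type*} [NormedAddCommGroup E] [InnerProductSpace ℂ E] [FiniteDimensional ℂ E]
variable {K : Type*} [NormedAddCommGroup K] [InnerProductSpace ℂ K] [FiniteDimensional ℂ K]

/-- The operators that commute with the mode of `φ` in the graded sense. -/
def gradedCentralizer (Z : E → Module.End ℂ K) (φ : E) : Subalgebra ℂ (Module.End ℂ K) :=
  Subalgebra.centralizer ℂ {Z φ * parity Z, star (Z φ) * parity Z}

/-- An even operator `ρ` satisfying, for the symbol `T`, the relations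
`Z((1 - T)ψ) ρ = ρ Z(Tψ)` and `Z*(Tψ) ρ = ρ Z*((1 - T)ψ)`. -/
structure IsKMS (Z : E → Module.End ℂ K) (T : E →L[ℂ] E) (ρ : Module.End ℂ K) : Prop where
  field_mul : ∀ ψ, Z (ψ - T ψ) * ρ = ρ * Z (T ψ)
  star_field_mul : ∀ ψ, star (Z (T ψ)) * ρ = ρ * star (Z (ψ - T ψ))
  even : Commute (parity Z) ρ

variable {Z : E →ₗ⋆[ℂ] Module.End ℂ K}

theorem IsCAR.parity_mul (hZ : IsCAR Z) (ψ : E) : parity Z * Z ψ = -(Z ψ * parity Z) := by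
  rw [hZ.mul_parity, neg_neg]

theorem IsCAR.parity_mul_star (hZ : IsCAR Z) (ψ : E) :
    parity Z * star (Z ψ) = -(star (Z ψ) * parity Z) := by
  rw [hZ.star_mul_parity, neg_neg]

theorem mem_gradedCentralizer {φ : E} {P : Module.End ℂ K} : P ∈ gradedCentralizer Z φ ↔
    Z φ * parity Z * P = P * (Z φ * parity Z) ∧
      star (Z φ) * parity Z * P = P * (star (Z φ) * parity Z) := by
  simp [gradedCentralizer, Subalgebra.mem_centralizer_iff]

/-- Z(ψ) anticommutes with the parity as well as with the mode of φ, so the two signs cancel.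
Inserting the parity makes graded commutation an ordinary commutant, hence a subalgebra, and
products of other modes need no sign bookkeeping. -/
theorem IsCAR.field_mem_gradedCentralizer (hZ : IsCAR Z) {φ ψ : E} (h : inner ℂ φ ψ = 0) :
    Z ψ ∈ gradedCentralizer Z φ ∧ star (Z ψ) ∈ gradedCentralizer Z φ := by
  have h' := inner_eq_zero_symm.1 h
  have e1 : parity Z * Z ψ = -(Z ψ * parity Z) := hZ.parity_mul ψ
  have e2 : parity Z * star (Z ψ) = -(star (Z ψ) * parity Z) := by rw [hZ.star_mul_parity, neg_neg]
  rw [mem_gradedCentralizer, mem_gradedCentralizer]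
  refine ⟨⟨?_, ?_⟩, ?_, ?_⟩
  · rw [mul_assoc, e1, mul_neg, ← mul_assoc, hZ.mul_comm_neg, neg_mul, neg_neg, mul_assoc]
  · rw [mul_assoc, e1, mul_neg, ← mul_assoc, hZ.star_mul_comm_neg' h, neg_mul, neg_neg, mul_assoc]
  · rw [mul_assoc, e2, mul_neg, ← mul_assoc, hZ.mul_star_comm_neg h, neg_mul, neg_neg, mul_assoc]
  · rw [mul_assoc, e2, mul_neg, ← mul_assoc, hZ.star_mul_comm_neg, neg_mul, neg_neg, mul_assoc]

theorem IsCAR.star_mem_gradedCentralizer (hZ : IsCAR Z) {φ : E} {P : Module.End ℂ K}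
    (h : P ∈ gradedCentralizer Z φ) : star P ∈ gradedCentralizer Z φ := by
  rw [mem_gradedCentralizer] at h ⊢
  have h1 := congrArg star h.1
  have h2 := congrArg star h.2
  simp only [star_mul, hZ.star_parity, star_star] at h1 h2
  rw [hZ.mul_parity, hZ.star_mul_parity, neg_mul, neg_mul, mul_neg, mul_neg, h1, h2]
  exact ⟨rfl, rfl⟩

theorem IsCAR.conj_mem_gradedCentralizer (hZ : IsCAR Z) {φ : E} {P : Module.End ℂ K}
    (h : P ∈ gradedCentralizer Z φ) : parity Z * P * parity Z ∈ gradedCentralizer Z φ := by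
  rw [mem_gradedCentralizer] at h ⊢
  have hW := hZ.parity_mul_parity
  have e1 : Z φ = -(parity Z * (Z φ * parity Z)) := by
    rw [hZ.mul_parity, mul_neg, neg_neg, ← mul_assoc, hW, one_mul]
  have e2 : star (Z φ) = -(parity Z * (star (Z φ) * parity Z)) := by
    rw [hZ.star_mul_parity, mul_neg, neg_neg, ← mul_assoc, hW, one_mul]
  constructor
  · calc Z φ * parity Z * (parity Z * P * parity Z)
        = Z φ * (parity Z * parity Z) * P * parity Z := by noncomm_ring
      _ = -(parity Z * (Z φ * parity Z * P) * parity Z) := by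
        rw [hW, mul_one]; nth_rw 1 [e1]; noncomm_ring
      _ = parity Z * P * -(Z φ * parity Z * parity Z) := by rw [h.1]; noncomm_ring
      _ = parity Z * P * parity Z * (Z φ * parity Z) := by
        rw [mul_assoc (parity Z * P) (parity Z), ← mul_assoc (parity Z) (Z φ), hZ.parity_mul, neg_mul]
  · calc star (Z φ) * parity Z * (parity Z * P * parity Z)
        = star (Z φ) * (parity Z * parity Z) * P * parity Z := by noncomm_ring
      _ = -(parity Z * (star (Z φ) * parity Z * P) * parity Z) := by
        rw [hW, mul_one]; nth_rw 1 [e2]; noncomm_ring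
      _ = parity Z * P * -(star (Z φ) * parity Z * parity Z) := by rw [h.2]; noncomm_ring
      _ = parity Z * P * parity Z * (star (Z φ) * parity Z) := by
        rw [mul_assoc (parity Z * P) (parity Z), ← mul_assoc (parity Z) (star (Z φ)),
          hZ.parity_mul_star, neg_mul]

/-- Elements of the graded centralizer are moved past the field at the cost of the grading. -/
theorem IsCAR.mul_of_mem_gradedCentralizer (hZ : IsCAR Z) {φ : E} {P : Module.End ℂ K}
    (h : P ∈ gradedCentralizer Z φ) :
    Z φ * P = parity Z * P * parity Z * Z φ ∧
      star (Z φ) * P = parity Z * P * parity Z * star (Z φ) := by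
  rw [mem_gradedCentralizer] at h
  have hW := hZ.parity_mul_parity
  have e1 : parity Z * Z φ = -(Z φ * parity Z) := by rw [hZ.mul_parity, neg_neg]
  have e2 : parity Z * star (Z φ) = -(star (Z φ) * parity Z) := by rw [hZ.star_mul_parity, neg_neg]
  constructor
  · rw [mul_assoc _ (parity Z), e1, mul_assoc, mul_neg, ← h.1, mul_neg, ← mul_assoc, ← mul_assoc,
      e1, neg_mul, neg_mul, neg_neg, mul_assoc (Z φ), hW, mul_one]
  · rw [mul_assoc _ (parity Z), e2, mul_assoc, mul_neg, ← h.2, mul_neg, ← mul_assoc, ← mul_assoc,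
      e2, neg_mul, neg_mul, neg_neg, mul_assoc (star (Z φ)), hW, mul_one]

theorem IsCAR.tau_conj (hZ : IsCAR Z) (x : Module.End ℂ K) :
    tau (parity Z * x * parity Z) = tau x := by
  rw [tau_mul_comm, ← mul_assoc, hZ.parity_mul_parity, one_mul]

namespace IsKMS

variable {T : E →L[ℂ] E} {ρ : Module.End ℂ K} (hρ : IsKMS Z T ρ)
include hρ

theorem smul_mul {φ : E} {m : ℝ} (h : T φ = (m : ℂ) • φ) :
    ((1 - m : ℝ) : ℂ) • (Z φ * ρ) = (m : ℂ) • (ρ * Z φ) := by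
  have := hρ.field_mul φ
  have e : φ - T φ = ((1 - m : ℝ) : ℂ) • φ := by rw [h]; push_cast; module
  rw [e, h] at this
  simpa [-Complex.coe_smul] using this

theorem smul_star_mul {φ : E} {m : ℝ} (h : T φ = (m : ℂ) • φ) :
    (m : ℂ) • (star (Z φ) * ρ) = ((1 - m : ℝ) : ℂ) • (ρ * star (Z φ)) := by
  have := hρ.star_field_mul φ
  have e : φ - T φ = ((1 - m : ℝ) : ℂ) • φ := by rw [h]; push_cast; module
  rw [e, h] at this
  simpa [-Complex.coe_smul] using this

variable (hZ : IsCAR Z) {φ : E} {m : ℝ} (h : T φ = (m : ℂ) • φ) {P : Module.End ℂ K}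
  (hP : P ∈ gradedCentralizer Z φ)
include hZ h hP

/-- Let t = τ(ZPρ) and let t' be the same average with P replaced by WPW. Conjugation by W gives t =
-t'; the exchange relation and cyclicity give (1 - m) t = m t'. Together t = 0, for every m. -/
theorem tau_field_mul : tau (Z φ * P * ρ) = 0 := by
  have e1 : tau (Z φ * P * ρ) = -tau (Z φ * (parity Z * P * parity Z) * ρ) := by
    have e : parity Z * Z φ = -(Z φ * parity Z) := by rw [hZ.mul_parity, neg_neg]
    rw [← hZ.tau_conj, ← tau_neg]
    congr 1
    calc parity Z * (Z φ * P * ρ) * parity Z = (parity Z * Z φ) * P * (ρ * parity Z) := by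
          noncomm_ring
      _ = -(Z φ * (parity Z * P * parity Z) * ρ) := by rw [e, ← hρ.even.eq]; noncomm_ring
  have e2 : ((1 - m : ℝ) : ℂ) * tau (Z φ * P * ρ) =
      m * tau (Z φ * (parity Z * P * parity Z) * ρ) := by
    rw [(hZ.mul_of_mem_gradedCentralizer hP).1, mul_assoc _ (Z φ), ← tau_smul, ← mul_smul_comm,
      hρ.smul_mul h, mul_smul_comm, tau_smul, ← mul_assoc, tau_mul_comm, ← mul_assoc]
  have e3 : tau (Z φ * (parity Z * P * parity Z) * ρ) = -tau (Z φ * P * ρ) := by rw [e1, neg_neg]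
  rw [e3] at e2
  push_cast at e2
  linear_combination e2

theorem tau_star_field_mul : tau (star (Z φ) * P * ρ) = 0 := by
  have e1 : tau (star (Z φ) * P * ρ) = -tau (star (Z φ) * (parity Z * P * parity Z) * ρ) := by
    have e : parity Z * star (Z φ) = -(star (Z φ) * parity Z) := by
      rw [hZ.star_mul_parity, neg_neg]
    rw [← hZ.tau_conj, ← tau_neg]
    congr 1
    calc parity Z * (star (Z φ) * P * ρ) * parity Z
          = (parity Z * star (Z φ)) * P * (ρ * parity Z) := by noncomm_ring
      _ = -(star (Z φ) * (parity Z * P * parity Z) * ρ) := by rw [e, ← hρ.even.eq]; noncomm_ring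
  have e2 : (m : ℂ) * tau (star (Z φ) * P * ρ) =
      ((1 - m : ℝ) : ℂ) * tau (star (Z φ) * (parity Z * P * parity Z) * ρ) := by
    rw [(hZ.mul_of_mem_gradedCentralizer hP).2, mul_assoc _ (star (Z φ)), ← tau_smul,
      ← mul_smul_comm, hρ.smul_star_mul h, mul_smul_comm, tau_smul, ← mul_assoc, tau_mul_comm,
      ← mul_assoc]
  have e3 : tau (star (Z φ) * (parity Z * P * parity Z) * ρ) = -tau (star (Z φ) * P * ρ) := by
    rw [e1, neg_neg]
  rw [e3] at e2
  push_cast at e2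
  linear_combination e2

/-- Carrying Z around the trace gives (1 - m) τ(Z*Z Pρ) = m τ(ZZ* Pρ), the grading of P being
removed by conjugation since ZZ* and ρ are even. Substituting ZZ* = 1 - Z*Z leaves the value m
τ(Pρ). -/
theorem tau_number_mul (hφ : ‖φ‖ = 1) :
    tau (star (Z φ) * Z φ * P * ρ) = m * tau (P * ρ) := by
  set Q := parity Z * P * parity Z with hQ
  have e1 : ((1 - m : ℝ) : ℂ) * tau (star (Z φ) * Z φ * P * ρ) =
      m * tau (Z φ * star (Z φ) * Q * ρ) := by
    rw [mul_assoc (star (Z φ)), (hZ.mul_of_mem_gradedCentralizer hP).1, ← hQ, mul_assoc,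
      mul_assoc, ← tau_smul, ← mul_smul_comm, ← mul_smul_comm, hρ.smul_mul h, mul_smul_comm,
      mul_smul_comm, tau_smul, ← mul_assoc, ← mul_assoc, tau_mul_comm, ← mul_assoc, ← mul_assoc]
  have e2 : tau (Z φ * star (Z φ) * Q * ρ) = tau (Z φ * star (Z φ) * P * ρ) := by
    have e : parity Z * (Z φ * star (Z φ)) = Z φ * star (Z φ) * parity Z := by
      rw [mul_assoc (Z φ), hZ.star_mul_parity, mul_neg, ← mul_assoc, ← mul_assoc, hZ.mul_parity,
        neg_mul, neg_neg]
    rw [← hZ.tau_conj (Z φ * star (Z φ) * P * ρ)]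
    congr 1
    calc Z φ * star (Z φ) * Q * ρ = (Z φ * star (Z φ) * parity Z) * P * (parity Z * ρ) := by
          rw [hQ]; noncomm_ring
      _ = parity Z * (Z φ * star (Z φ) * P * ρ) * parity Z := by
          rw [← e, hρ.even.eq]; noncomm_ring
  rw [e2, hZ.car_unit hφ, sub_mul, sub_mul, one_mul, tau_sub] at e1
  push_cast at e1
  linear_combination e1

end IsKMS

/-- The normalized trace is the Gaussian state of symbol 1/2, so traces of products of even factors
come from the same averaging formula. -/
theorem isKMS_one :
    IsKMS Z (((1 / 2 : ℝ) : ℂ) • ContinuousLinearMap.id ℂ E) (1 : Module.End ℂ K) := by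
  have h : ∀ ψ : E, ψ - (((1 / 2 : ℝ) : ℂ) • ContinuousLinearMap.id ℂ E) ψ =
      (((1 / 2 : ℝ) : ℂ) • ContinuousLinearMap.id ℂ E) ψ := fun ψ => by
    simp only [smul_apply, ContinuousLinearMap.id_apply]
    push_cast
    module
  exact ⟨fun ψ => by rw [h, one_mul, mul_one], fun ψ => by rw [h, one_mul, mul_one],
    Commute.one_right _⟩

theorem IsCAR.tau_number_mul_eq_half (hZ : IsCAR Z) {φ : E} (hφ : ‖φ‖ = 1) {P : Module.End ℂ K}
    (hP : P ∈ gradedCentralizer Z φ) : tau (star (Z φ) * Z φ * P) = 1 / 2 * tau P := by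
  have := IsKMS.tau_number_mul isKMS_one hZ (m := 1 / 2) (by simp) hP hφ
  simpa using this

theorem IsCAR.tau_evenProd (hZ : IsCAR Z) : ∀ {N : ℕ} {v : Fin N → E} (_ : Orthonormal ℂ v)
    (a b : Fin N → ℝ), tau (List.ofFn fun j => evenFactor Z (v j) (a j) (b j)).prod =
      (∏ j, ((a j : ℂ) + b j / 2)) * tau (1 : Module.End ℂ K)
  | 0, _, _, _, _ => by simp
  | N + 1, v, hv, a, b => by
    have hv' : Orthonormal ℂ fun j : Fin N => v j.succ := hv.comp _ (Fin.succ_injective N)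
    have hmem : (List.ofFn fun j : Fin N => evenFactor Z (v j.succ) (a j.succ) (b j.succ)).prod ∈
        gradedCentralizer Z (v 0) := prod_ofFn_mem _ fun j => by
      have := hZ.field_mem_gradedCentralizer (hv.2 (Fin.succ_ne_zero j).symm)
      exact add_mem (Subalgebra.smul_mem _ (one_mem _) _)
        (Subalgebra.smul_mem _ (mul_mem this.2 this.1) _)
    rw [List.ofFn_succ, List.prod_cons, Fin.prod_univ_succ]
    nth_rw 1 [evenFactor]
    rw [add_mul, smul_mul_assoc, one_mul, smul_mul_assoc, tau_add, tau_smul, tau_smul,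
      hZ.tau_number_mul_eq_half (hv.1 0) hmem, hZ.tau_evenProd hv']
    ring

/-- The projection ∏ Z_j* Z_j has normalized trace 2^{-N}, so dim K is 2^N times its rank, and the
rank is nonzero because `K` is. -/
theorem IsCAR.two_pow_le_finrank [Nontrivial K] (hZ : IsCAR Z) {N : ℕ} {v : Fin N → E}
    (hv : Orthonormal ℂ v) : 2 ^ N ≤ Module.finrank ℂ K := by
  set p := (List.ofFn fun j => evenFactor Z (v j) 0 1).prod with hp
  have hidem : IsIdempotentElem p := by
    refine prod_ofFn_mul_self (fun j => ?_) (hZ.evenFactor_commute hv _ _)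
    simp [evenFactor, hZ.number_mul_number (hv.1 j)]
  have htr : LinearMap.trace ℂ K p = (Module.finrank ℂ (LinearMap.range p) : ℂ) :=
    (LinearMap.IsIdempotentElem.isProj_range _ hidem).trace
  have htau := hZ.tau_evenProd hv (fun _ => 0) (fun _ => 1)
  have hd : (Module.finrank ℂ K : ℂ) ≠ 0 := Nat.cast_ne_zero.2 Module.finrank_pos.ne'
  rw [← hp, tau_one, tau, htr] at htau
  simp only [Complex.ofReal_zero, Complex.ofReal_one, zero_add, Finset.prod_const,
    Finset.card_univ, Fintype.card_fin, mul_one] at htau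
  have h2 : (Module.finrank ℂ K : ℂ) = 2 ^ N * Module.finrank ℂ (LinearMap.range p) := by
    field_simp at htau
    rw [htau, mul_left_comm, ← mul_pow]
    norm_num
  have h3 : Module.finrank ℂ K = 2 ^ N * Module.finrank ℂ (LinearMap.range p) := by
    exact_mod_cast h2
  rw [h3]
  refine Nat.le_mul_of_pos_right _ (Nat.pos_of_ne_zero fun h0 => ?_)
  rw [h0, mul_zero] at h3
  exact Module.finrank_pos.ne' h3

/-- There are 4^N products and they span a space of dimension (dim K)² ≥ 4^N, so there is no room
for a relation. -/
theorem linearIndependent_modeProd [Nontrivial K] (hZ : IsCAR Z) (htop : carAlgebra Z = ⊤) {N : ℕ}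
    (ψ : OrthonormalBasis (Fin N) ℂ E) (μ : Fin N → ℝ) :
    LinearIndependent ℂ (modeProd (fun j => Z (ψ j)) μ) := by
  have hspan := span_modeProd_eq_top hZ htop ψ μ
  refine linearIndependent_of_top_le_span_of_card_eq_finrank hspan.ge (le_antisymm ?_ ?_)
  · rw [Module.finrank_linearMap]
    calc Fintype.card (Fin N → Fin 2 × Fin 2) = 2 ^ N * 2 ^ N := by
          simp [← mul_pow]
      _ ≤ _ := Nat.mul_le_mul (hZ.two_pow_le_finrank ψ.orthonormal)
          (hZ.two_pow_le_finrank ψ.orthonormal)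
  · have := finrank_range_le_card (R := ℂ) (modeProd (fun j => Z (ψ j)) μ)
    rwa [Set.finrank, hspan, finrank_top] at this

/-- A CAR field that generates all operators maps to every other CAR field over the same space. -/
theorem exists_starAlgHom [Nontrivial K] (hZ : IsCAR Z) (htop : carAlgebra Z = ⊤)
    {L : Type*} [NormedAddCommGroup L] [InnerProductSpace ℂ L] [FiniteDimensional ℂ L]
    {Z' : E →ₗ⋆[ℂ] Module.End ℂ L} (hZ' : IsCAR Z') :
    ∃ f : Module.End ℂ K →⋆ₐ[ℂ] Module.End ℂ L, ∀ ξ, f (Z ξ) = Z' ξ := by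
  -- The homomorphism is obtained from its graph, the *-algebra generated by the pairs (Z ξ, Z' ξ).
  let Y : E →ₗ⋆[ℂ] Module.End ℂ K × Module.End ℂ L :=
    { toFun := fun ξ => (Z ξ, Z' ξ)
      map_add' := fun _ _ => by simp
      map_smul' := fun _ _ => by simp }
  let A := StarAlgebra.adjoin ℂ (Set.range Y)
  let ψ := stdOrthonormalBasis ℂ E
  have hY : IsCARFamily fun j => Y (ψ j) := by
    have h1 := hZ.isCARFamily ψ.orthonormal
    have h2 := hZ'.isCARFamily ψ.orthonormal
    refine ⟨fun j k => Prod.ext (h1.ann j k) (h2.ann j k), fun j k => Prod.ext ?_ ?_⟩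
    · refine (h1.car j k).trans ?_
      split_ifs <;> rfl
    · refine (h2.car j k).trans ?_
      split_ifs <;> rfl
  let fst : A →⋆ₐ[ℂ] Module.End ℂ K := (StarAlgHom.fst ℂ _ _).comp A.subtype
  have hfst : ∀ α, (modeProd (fun j => Y (ψ j)) 0 α).1 = modeProd (fun j => Z (ψ j)) 0 α := by
    intro α
    exact map_modeProd (StarAlgHom.fst ℂ (Module.End ℂ K) (Module.End ℂ L)) _ _ _
  -- The graph is spanned by the ordered products of the pairs, and their first components are
  -- independent; so the first component determines the second.
  have hinj : Function.Injective fst := by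
    rw [injective_iff_map_eq_zero]
    rintro ⟨x, hx⟩ h0
    change x.1 = 0 at h0
    have := adjoin_le_span_modeProd ψ Y hY 0 hx
    obtain ⟨c, rfl⟩ := (Submodule.mem_span_range_iff_exists_fun ℂ).1 this
    have hc : ∑ α, c α • modeProd (fun j => Z (ψ j)) 0 α = 0 := by
      rw [← h0, Prod.fst_sum]
      exact Finset.sum_congr rfl fun α _ => by rw [Prod.smul_fst, hfst]
    have := Fintype.linearIndependent_iff.1 (linearIndependent_modeProd hZ htop ψ 0) c hc
    simp only [this, zero_smul, Finset.sum_const_zero]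
    rfl
  have hsurj : Function.Surjective fst := by
    intro x
    have hx : x ∈ carAlgebra Z := htop ▸ trivial
    have hle : carAlgebra Z ≤ fst.range := by
      refine StarAlgebra.adjoin_le ?_
      rintro _ ⟨ξ, rfl⟩
      exact ⟨⟨Y ξ, StarAlgebra.subset_adjoin ℂ _ ⟨ξ, rfl⟩⟩, rfl⟩
    exact hle hx
  let e := StarAlgEquiv.ofBijective fst ⟨hinj, hsurj⟩
  refine ⟨((StarAlgHom.snd ℂ _ _).comp A.subtype).comp (e.symm : Module.End ℂ K →⋆ₐ[ℂ] A),
    fun ξ => ?_⟩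
  have : e.symm (Z ξ) = ⟨Y ξ, StarAlgebra.subset_adjoin ℂ _ ⟨ξ, rfl⟩⟩ := by
    rw [StarAlgEquiv.symm_apply_eq]
    rfl
  change (e.symm (Z ξ)).1.2 = _
  rw [this]
  rfl

end KMS

/-! ### Gauge invariant Gaussian density matrices -/

section Gaussian

variable {E : Type*} [NormedAddCommGroup E] [InnerProductSpace ℂ E] [FiniteDimensional ℂ E]
variable {K : Type*} [NormedAddCommGroup K] [InnerProductSpace ℂ K] [FiniteDimensional ℂ K]
variable {Z : E →ₗ⋆[ℂ] Module.End ℂ K}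

omit [FiniteDimensional ℂ E] in
theorem IsCAR.gaussianProduct_eq (hZ : IsCAR Z) {N : ℕ} {v : Fin N → E} (hv : Orthonormal ℂ v)
    (μ : Fin N → ℝ) : gaussianProduct Z v μ =
      (List.ofFn fun j => evenFactor Z (v j) (2 * (1 - μ j)) (4 * μ j - 2)).prod := by
  unfold gaussianProduct
  congr 2
  funext j
  rw [hZ.car_unit (hv.1 j), evenFactor]
  push_cast
  module

theorem IsCAR.isKMS_gaussianProduct (hZ : IsCAR Z) {N : ℕ} (ψ : OrthonormalBasis (Fin N) ℂ E)
    (μ : Fin N → ℝ) {T : E →L[ℂ] E} (hT : ∀ j, T (ψ j) = (μ j : ℂ) • ψ j) :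
    IsKMS Z T (gaussianProduct Z ψ μ) := by
  have hv := ψ.orthonormal
  rw [hZ.gaussianProduct_eq hv]
  set ρ := (List.ofFn fun j => evenFactor Z (ψ j) (2 * (1 - μ j)) (4 * μ j - 2)).prod with hρ
  have h1 : ∀ j, ψ j - T (ψ j) = ((1 - μ j : ℝ) : ℂ) • ψ j := fun j => by
    rw [hT]; push_cast; module
  have e1 : ∀ j, Z (ψ j - T (ψ j)) * ρ = ρ * Z (T (ψ j)) := fun j => by
    -- Here a + b = 2μ, so both sides of the required scalar identity are 2μ(1 - μ).
    have := hZ.smul_mul_evenProd hv (a := fun j => 2 * (1 - μ j)) (b := fun j => 4 * μ j - 2)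
      (x := ((1 - μ j : ℝ) : ℂ)) (y := μ j) j (by push_cast; ring)
    rw [h1, hT]
    simpa [-Complex.coe_smul] using this
  have e2 : ∀ j, star (Z (T (ψ j))) * ρ = ρ * star (Z (ψ j - T (ψ j))) := fun j => by
    have := hZ.smul_star_mul_evenProd hv (a := fun j => 2 * (1 - μ j)) (b := fun j => 4 * μ j - 2)
      (x := μ j) (y := ((1 - μ j : ℝ) : ℂ)) j (by push_cast; ring)
    rw [h1, hT]
    simpa [-Complex.coe_smul] using this
  refine ⟨fun φ => ?_, fun φ => ?_, commute_prod_ofFn fun j => ?_⟩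
  · rw [← ψ.sum_repr' φ, map_sum, ← Finset.sum_sub_distrib]
    simp only [map_smul, ← smul_sub, map_sum, map_smulₛₗ, Finset.sum_mul, Finset.mul_sum,
      smul_mul_assoc, mul_smul_comm, e1]
  · rw [← ψ.sum_repr' φ, map_sum, ← Finset.sum_sub_distrib]
    simp only [map_smul, ← smul_sub, map_sum, map_smulₛₗ, Finset.sum_mul, Finset.mul_sum,
      smul_mul_assoc, mul_smul_comm, star_sum, star_smul, e2]
  · have : Commute (parity Z) (star (Z (ψ j)) * Z (ψ j)) := by
      rw [Commute, SemiconjBy, ← mul_assoc, hZ.parity_mul_star, neg_mul, mul_assoc,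
        hZ.parity_mul, mul_neg, neg_neg, mul_assoc]
    exact ((Commute.one_right _).smul_right _).add_right (this.smul_right _)

omit [FiniteDimensional ℂ E] in
theorem IsCAR.star_gaussianProduct (hZ : IsCAR Z) {N : ℕ} {v : Fin N → E} (hv : Orthonormal ℂ v)
    (μ : Fin N → ℝ) : star (gaussianProduct Z v μ) = gaussianProduct Z v μ := by
  rw [hZ.gaussianProduct_eq hv]
  exact star_prod_ofFn (fun j => star_evenFactor _ _ _ _) (hZ.evenFactor_commute hv _ _)

theorem IsCAR.tau_gaussianProduct [Nontrivial K] (hZ : IsCAR Z) {N : ℕ} {v : Fin N → E}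
    (hv : Orthonormal ℂ v) (μ : Fin N → ℝ) : tau (gaussianProduct Z v μ) = 1 := by
  rw [hZ.gaussianProduct_eq hv, hZ.tau_evenProd hv, tau_one, mul_one]
  refine Finset.prod_eq_one fun j _ => ?_
  push_cast
  ring

variable [CompleteSpace E]

theorem exists_gigDensity_eq (Z : E → Module.End ℂ K) {T : E →L[ℂ] E} (hT : IsSelfAdjoint T) :
    ∃ (ψ : OrthonormalBasis (Fin (Module.finrank ℂ E)) ℂ E) (μ : Fin (Module.finrank ℂ E) → ℝ),
      (∀ j, T (ψ j) = (μ j : ℂ) • ψ j) ∧ gigDensity Z T = gaussianProduct Z ψ μ := by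
  refine ⟨hT.isSymmetric.eigenvectorBasis rfl, hT.isSymmetric.eigenvalues rfl, fun j => ?_, ?_⟩
  · exact hT.isSymmetric.apply_eigenvectorBasis rfl j
  · rw [gigDensity, dif_pos hT]

theorem IsCAR.gigDensity_spec [Nontrivial K] (hZ : IsCAR Z) {T : E →L[ℂ] E}
    (hT : IsSelfAdjoint T) : IsKMS Z T (gigDensity Z T) ∧
      star (gigDensity Z T) = gigDensity Z T ∧ tau (gigDensity Z T) = 1 := by
  obtain ⟨ψ, μ, h, e⟩ := exists_gigDensity_eq Z hT
  rw [e]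
  exact ⟨hZ.isKMS_gaussianProduct ψ μ h, hZ.star_gaussianProduct ψ.orthonormal μ,
    hZ.tau_gaussianProduct ψ.orthonormal μ⟩

end Gaussian

/-! ### Orthogonality of the Hermite operators -/

section Orthogonality

variable {E : Type*} [NormedAddCommGroup E] [InnerProductSpace ℂ E] [FiniteDimensional ℂ E]
variable {K : Type*} [NormedAddCommGroup K] [InnerProductSpace ℂ K] [FiniteDimensional ℂ K]
variable {Z : E →ₗ⋆[ℂ] Module.End ℂ K}

theorem IsKMS.tau_modeOp_mul {T : E →L[ℂ] E} {ρ : Module.End ℂ K} (hρ : IsKMS Z T ρ)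
    (hZ : IsCAR Z) {φ : E} (hφ : ‖φ‖ = 1) {m : ℝ} (h : T φ = (m : ℂ) • φ) {P : Module.End ℂ K}
    (hP : P ∈ gradedCentralizer Z φ) {a : Fin 2 × Fin 2} (ha : a ≠ (0, 0)) :
    tau (modeOp (Z φ) m a * P * ρ) = 0 := by
  fin_cases a
  · exact absurd rfl ha
  · exact hρ.tau_field_mul hZ h hP
  · exact hρ.tau_star_field_mul hZ h hP
  · change tau ((star (Z φ) * Z φ - (m : ℂ) • (1 : Module.End ℂ K)) * P * ρ) = 0
    rw [sub_mul, sub_mul, tau_sub, hρ.tau_number_mul hZ h hP hφ, smul_mul_assoc, smul_mul_assoc,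
      tau_smul, one_mul, sub_self]

/-- An odd one-mode operator replaces P by WPW, an even one leaves it alone. This brings the mode to
the front, where its average against ρ is known to vanish. -/
theorem IsCAR.exists_mul_modeOp (hZ : IsCAR Z) {φ : E} {P : Module.End ℂ K}
    (hP : P ∈ gradedCentralizer Z φ) (m : ℝ) (a : Fin 2 × Fin 2) :
    ∃ P' ∈ gradedCentralizer Z φ, P * modeOp (Z φ) m a = modeOp (Z φ) m a * P' := by
  have hW := hZ.parity_mul_parity
  have hP' := hZ.conj_mem_gradedCentralizer hP
  have h1 := hZ.mul_of_mem_gradedCentralizer hP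
  have h2 := hZ.mul_of_mem_gradedCentralizer hP'
  have e : parity Z * (parity Z * P * parity Z) * parity Z = P := by
    rw [← mul_assoc, ← mul_assoc, hW, one_mul, mul_assoc, hW, mul_one]
  rw [e] at h2
  fin_cases a
  · exact ⟨P, hP, by simp [modeOp]⟩
  · exact ⟨_, hP', h2.1.symm⟩
  · exact ⟨_, hP', h2.2.symm⟩
  · refine ⟨P, hP, ?_⟩
    change P * (star (Z φ) * Z φ - (m : ℂ) • (1 : Module.End ℂ K)) =
      (star (Z φ) * Z φ - (m : ℂ) • (1 : Module.End ℂ K)) * P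
    rw [mul_sub, sub_mul, ← mul_assoc, ← h2.2, mul_assoc (star (Z φ)), mul_assoc (star (Z φ)), ← h1.1,
      mul_smul_comm, smul_mul_assoc, one_mul, mul_one]

omit [FiniteDimensional ℂ E] in
-- The multiplication table of one mode: off the diagonal no identity component appears, which is
-- the one-mode form of orthogonality.
theorem IsCAR.star_modeOp_mul_of_ne (hZ : IsCAR Z) {φ : E} (hφ : ‖φ‖ = 1) (m : ℝ)
    {a b : Fin 2 × Fin 2} (hab : a ≠ b) : ∃ (c : ℂ) (d : Fin 2 × Fin 2), d ≠ (0, 0) ∧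
      star (modeOp (Z φ) m a) * modeOp (Z φ) m b = c • modeOp (Z φ) m d := by
  have h1 := hZ.mul_number hφ
  have h2 := hZ.number_mul φ
  have h3 := hZ.star_mul_number φ
  have h4 := hZ.number_mul_star hφ
  have h5 := hZ.mul_self φ
  have h6 := hZ.star_mul_self φ
  fin_cases a <;> fin_cases b
  · exact absurd rfl hab
  · exact ⟨1, (0, 1), by simp, by simp [modeOp]⟩
  · exact ⟨1, (1, 0), by simp, by simp [modeOp]⟩
  · exact ⟨1, (1, 1), by simp, by simp [modeOp]⟩
  · exact ⟨1, (1, 0), by simp, by simp [modeOp]⟩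
  · exact absurd rfl hab
  · exact ⟨0, (1, 0), by simp, by simp [modeOp, h6]⟩
  · exact ⟨-m, (1, 0), by simp, by simp [modeOp, mul_sub, h3]⟩
  · exact ⟨1, (0, 1), by simp, by simp [modeOp]⟩
  · exact ⟨0, (0, 1), by simp, by simp [modeOp, h5]⟩
  · exact absurd rfl hab
  · exact ⟨1 - m, (0, 1), by simp, by simp [modeOp, mul_sub, h1, sub_smul]⟩
  · exact ⟨1, (1, 1), by simp, by simp [modeOp]⟩
  · exact ⟨-m, (0, 1), by simp, by simp [modeOp, sub_mul, h2]⟩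
  · exact ⟨1 - m, (1, 0), by simp, by simp [modeOp, sub_mul, h4, sub_smul]⟩
  · exact absurd rfl hab

omit [FiniteDimensional ℂ E] in
theorem IsCAR.star_modeOp_mul_self (hZ : IsCAR Z) {φ : E} (hφ : ‖φ‖ = 1) (m : ℝ)
    (a : Fin 2 × Fin 2) : ∃ k c : ℂ, star (modeOp (Z φ) m a) * modeOp (Z φ) m a =
      k • (1 : Module.End ℂ K) + c • modeOp (Z φ) m (1, 1) := by
  have h1 := hZ.car_unit hφ
  have h2 := hZ.number_mul_number hφ
  fin_cases a
  · exact ⟨1, 0, by simp [modeOp]⟩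
  · exact ⟨m, 1, by simp [modeOp]⟩
  · refine ⟨1 - m, -1, ?_⟩
    simp only [modeOp, star_star, h1]
    module
  -- With n = Z*Z a projection, (n - m)² = m(1 - m) + (1 - 2m)(n - m); the constant is the variance
  -- of the occupation number.
  · refine ⟨m * (1 - m), 1 - 2 * m, ?_⟩
    simp only [modeOp, star_sub, star_mul, star_star, star_smul, star_one, mul_sub, sub_mul, h2,
      mul_smul_comm, smul_mul_assoc, mul_one, one_mul]
    simp only [Complex.star_def, Complex.conj_ofReal]
    module

/-- Distinct Hermite operators are orthogonal in the GNS inner product. -/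
theorem IsKMS.tau_star_modeProd_mul {T : E →L[ℂ] E} {ρ : Module.End ℂ K} (hρ : IsKMS Z T ρ)
    (hZ : IsCAR Z) : ∀ {N : ℕ} {v : Fin N → E} (_ : Orthonormal ℂ v) {μ : Fin N → ℝ}
    (_ : ∀ j, T (v j) = (μ j : ℂ) • v j) {α β : Fin N → Fin 2 × Fin 2} (_ : α ≠ β),
    tau (star (modeProd (fun j => Z (v j)) μ α) * modeProd (fun j => Z (v j)) μ β * ρ) = 0
  | 0, _, _, _, _, _, _, h => absurd (Subsingleton.elim _ _) h
  | N + 1, v, hv, μ, hT, α, β, hαβ => by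
    have hv' : Orthonormal ℂ fun j : Fin N => v j.succ := hv.comp _ (Fin.succ_injective N)
    have hmem : ∀ γ, modeProd (fun j : Fin N => Z (v j.succ)) (fun j => μ j.succ) γ ∈
        gradedCentralizer Z (v 0) := fun γ => modeProd_mem _
      (fun j => (hZ.field_mem_gradedCentralizer (hv.2 (Fin.succ_ne_zero j).symm)).1)
      (fun j => (hZ.field_mem_gradedCentralizer (hv.2 (Fin.succ_ne_zero j).symm)).2) _ _
    rw [modeProd_succ, modeProd_succ, star_mul]
    set A := modeProd (fun j : Fin N => Z (v j.succ)) (fun j => μ j.succ) fun j => α j.succ with hA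
    set B := modeProd (fun j : Fin N => Z (v j.succ)) (fun j => μ j.succ) fun j => β j.succ with hB
    have hvan : ∀ d : Fin 2 × Fin 2, d ≠ (0, 0) →
        tau (star A * modeOp (Z (v 0)) (μ 0) d * B * ρ) = 0 := fun d hd => by
      obtain ⟨P, hP, e⟩ := hZ.exists_mul_modeOp (hZ.star_mem_gradedCentralizer (hmem _)) (μ 0) d
      rw [hA, e, mul_assoc (modeOp _ _ _)]
      exact hρ.tau_modeOp_mul hZ (hv.1 0) (hT 0) (mul_mem hP (hmem _)) hd
    rw [mul_assoc (star A), ← mul_assoc (star (modeOp _ _ _))]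
    -- Equal first indices leave a scalar, settled by induction on the other modes, and a centered
    -- number operator, which averages to zero; unequal ones leave only a term averaging to zero.
    rcases eq_or_ne (α 0) (β 0) with h0 | h0
    · obtain ⟨k, c, e⟩ := hZ.star_modeOp_mul_self (hv.1 0) (μ 0) (α 0)
      have hne : (fun j : Fin N => α j.succ) ≠ fun j => β j.succ := fun h =>
        hαβ (funext fun j => Fin.cases h0 (fun j => congrFun h j) j)
      have ih := hρ.tau_star_modeProd_mul hZ hv' (fun j => hT j.succ) hne
      rw [← h0, e, add_mul, mul_add, add_mul, tau_add, smul_mul_assoc, one_mul, mul_smul_comm,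
        smul_mul_assoc, tau_smul, ih, smul_mul_assoc, mul_smul_comm, smul_mul_assoc, tau_smul,
        ← mul_assoc, hvan _ (by simp), mul_zero, mul_zero, add_zero]
    · obtain ⟨c, d, hd, e⟩ := hZ.star_modeOp_mul_of_ne (hv.1 0) (μ 0) h0
      rw [e, smul_mul_assoc, mul_smul_comm, smul_mul_assoc, tau_smul, ← mul_assoc, hvan d hd,
        mul_zero]

end Orthogonality

/-! ### Hilbert-Schmidt adjoints -/

section Adjoint

variable {K : Type*} [NormedAddCommGroup K] [InnerProductSpace ℂ K] [FiniteDimensional ℂ K]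
variable {L : Type*} [NormedAddCommGroup L] [InnerProductSpace ℂ L]

theorem exists_tau_adjoint [FiniteDimensional ℂ L] (f : Module.End ℂ K →ₗ[ℂ] Module.End ℂ L) :
    ∃ g : Module.End ℂ L →ₗ[ℂ] Module.End ℂ K,
      ∀ X Y, tau (star (g X) * Y) = tau (star X * f Y) := by
  let t : ∀ (M : Type _) [NormedAddCommGroup M] [InnerProductSpace ℂ M],
      Module.End ℂ M →ₗ[ℂ] ℂ := fun M _ _ =>
    { toFun := tau, map_add' := tau_add, map_smul' := tau_smul }
  -- The bilinear form τ(xy) is nondegenerate, hence represents every functional; the two stars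
  -- below turn it into the sesquilinear pairing while keeping the adjoint linear.
  let D : Module.End ℂ K →ₗ[ℂ] Module.Dual ℂ (Module.End ℂ K) :=
    (LinearMap.mul ℂ (Module.End ℂ K)).compr₂ (t K)
  have hD : Function.Injective D := by
    rw [injective_iff_map_eq_zero]
    intro x hx
    refine eq_of_tau_mul_eq fun z => ?_
    rw [mul_zero, tau_zero, tau_mul_comm]
    exact LinearMap.congr_fun hx z
  let e := LinearEquiv.ofInjectiveOfFinrankEq D hD (Subspace.dual_finrank_eq).symm
  let F : Module.End ℂ L →ₗ[ℂ] Module.Dual ℂ (Module.End ℂ K) :=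
    { toFun := fun X => { toFun := fun Y => tau (X * f Y)
                          map_add' := fun _ _ => by rw [map_add, mul_add, tau_add]
                          map_smul' := fun _ _ => by simp [tau_smul] }
      map_add' := fun _ _ => by ext; simp [add_mul, tau_add]
      map_smul' := fun _ _ => by ext; simp [tau_smul] }
  refine ⟨{ toFun := fun X => star (e.symm (F (star X)))
            map_add' := fun _ _ => by simp
            map_smul' := fun _ _ => by simp }, fun X Y => ?_⟩
  have := LinearMap.congr_fun (e.apply_symm_apply (F (star X))) Y
  change tau (star (star (e.symm (F (star X)))) * Y) = _
  rw [star_star]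
  exact this

theorem hsAdjoint_spec (f : Module.End ℂ K →ₗ[ℂ] Module.End ℂ K) : IsHSAdjoint f (hsAdjoint f) := by
  have h : ∃ g, IsHSAdjoint f g := exists_tau_adjoint f
  rw [hsAdjoint, dif_pos h]
  exact h.choose_spec

end Adjoint

/-! ### Operators on the doubled space -/

section Kron

variable {K : Type*} [NormedAddCommGroup K] [InnerProductSpace ℂ K]

/-- The Hilbert space `K ⊗ K`, as a type whose only algebraic structure is the one of its inner
product space structure. -/
def TensorSquare (K : Type*) [NormedAddCommGroup K] [InnerProductSpace ℂ K] : Type _ := K ⊗[ℂ] K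

instance : NormedAddCommGroup (TensorSquare K) := inferInstanceAs (NormedAddCommGroup (K ⊗[ℂ] K))

instance : InnerProductSpace ℂ (TensorSquare K) := inferInstanceAs (InnerProductSpace ℂ (K ⊗[ℂ] K))

instance [FiniteDimensional ℂ K] : FiniteDimensional ℂ (TensorSquare K) :=
  inferInstanceAs (FiniteDimensional ℂ (K ⊗[ℂ] K))

instance [Nontrivial K] : Nontrivial (TensorSquare K) :=
  inferInstanceAs (Nontrivial (K ⊗[ℂ] K))

/-- The tensor product of two operators. -/
def kron (X Y : Module.End ℂ K) : Module.End ℂ (TensorSquare K) := TensorProduct.map X Y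

theorem kron_mul (X Y X' Y' : Module.End ℂ K) :
    kron X Y * kron X' Y' = kron (X * X') (Y * Y') :=
  (TensorProduct.map_mul X X' Y Y').symm

theorem kron_one : kron (1 : Module.End ℂ K) 1 = 1 := TensorProduct.map_one

theorem kron_add (X Y Y' : Module.End ℂ K) : kron X (Y + Y') = kron X Y + kron X Y' :=
  TensorProduct.map_add_right _ _ _

theorem add_kron (X X' Y : Module.End ℂ K) : kron (X + X') Y = kron X Y + kron X' Y :=
  TensorProduct.map_add_left _ _ _

theorem kron_smul (c : ℂ) (X Y : Module.End ℂ K) : kron X (c • Y) = c • kron X Y :=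
  TensorProduct.map_smul_right _ _ _

theorem smul_kron (c : ℂ) (X Y : Module.End ℂ K) : kron (c • X) Y = c • kron X Y :=
  TensorProduct.map_smul_left _ _ _

theorem kron_zero (X : Module.End ℂ K) : kron X 0 = 0 := TensorProduct.map_zero_right X

theorem zero_kron (X : Module.End ℂ K) : kron 0 X = 0 := TensorProduct.map_zero_left X

theorem kron_neg (X Y : Module.End ℂ K) : kron X (-Y) = -kron X Y := by
  rw [← neg_one_smul ℂ Y, kron_smul]
  exact neg_one_smul ℂ _

theorem neg_kron (X Y : Module.End ℂ K) : kron (-X) Y = -kron X Y := by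
  rw [← neg_one_smul ℂ X, smul_kron]
  exact neg_one_smul ℂ _

theorem kron_sub (X Y Y' : Module.End ℂ K) : kron X (Y - Y') = kron X Y - kron X Y' := by
  rw [sub_eq_add_neg, kron_add, kron_neg, sub_eq_add_neg]

theorem sub_kron (X X' Y : Module.End ℂ K) : kron (X - X') Y = kron X Y - kron X' Y := by
  rw [sub_eq_add_neg, add_kron, neg_kron, sub_eq_add_neg]

variable [FiniteDimensional ℂ K]

theorem star_kron (X Y : Module.End ℂ K) : star (kron X Y) = kron (star X) (star Y) :=
  TensorProduct.adjoint_map X Y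

theorem tau_kron (X Y : Module.End ℂ K) : tau (kron X Y) = tau X * tau Y := by
  have h1 : LinearMap.trace ℂ (TensorSquare K) (kron X Y) =
      LinearMap.trace ℂ K X * LinearMap.trace ℂ K Y := LinearMap.trace_tensorProduct' X Y
  have h2 : Module.finrank ℂ (TensorSquare K) = Module.finrank ℂ K * Module.finrank ℂ K :=
    Module.finrank_tensorProduct
  rw [tau, tau, tau, h1, h2, Nat.cast_mul, mul_inv]
  ring

theorem span_kron_eq_top : Submodule.span ℂ
    (Set.range fun p : Module.End ℂ K × Module.End ℂ K => kron p.1 p.2) = ⊤ := by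
  refine Submodule.eq_top_iff'.2 fun x => ?_
  obtain ⟨t, rfl⟩ := (homTensorHomEquiv ℂ K K K K).surjective x
  induction t using TensorProduct.induction_on with
  | zero => rw [map_zero]; exact zero_mem _
  | tmul X Y =>
    refine Submodule.subset_span ⟨(X, Y), ?_⟩
    simp only [homTensorHomEquiv_apply, TensorProduct.homTensorHomMap_apply]
    rfl
  | add x y hx hy =>
    rw [map_add]
    exact add_mem hx hy

end Kron

/-! ### The doubled CAR field, its two embeddings, and the pairing formula. -/

section Doubling

variable {E : Type*} [NormedAddCommGroup E] [InnerProductSpace ℂ E] [FiniteDimensional ℂ E]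
variable {K : Type*} [NormedAddCommGroup K] [InnerProductSpace ℂ K] [FiniteDimensional ℂ K]
variable {Z : E →ₗ⋆[ℂ] Module.End ℂ K}

/-- `doubledField`, on `TensorSquare K`. -/
def squareField (Z : E → Module.End ℂ K) (ξ : WithLp 2 (E × E)) : Module.End ℂ (TensorSquare K) :=
  doubledField Z ξ

/-- `fieldA`, on `TensorSquare K`. -/
def squareFieldA (Z : E → Module.End ℂ K) (ψ : E) : Module.End ℂ (TensorSquare K) :=
  squareField Z (WithLp.toLp 2 (ψ, 0))

/-- `fieldB`, on `TensorSquare K`. -/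
def squareFieldB (Z : E → Module.End ℂ K) (ψ : E) : Module.End ℂ (TensorSquare K) :=
  squareField Z (WithLp.toLp 2 (0, ψ))

theorem squareField_eq (Z : E → Module.End ℂ K) (ξ : WithLp 2 (E × E)) :
    squareField Z ξ = kron (Z ξ.fst) (parity Z) + kron 1 (Z ξ.snd) := rfl

theorem squareFieldA_eq (Z : E →ₗ⋆[ℂ] Module.End ℂ K) (ψ : E) :
    squareFieldA Z ψ = kron (Z ψ) (parity Z) := by
  rw [squareFieldA, squareField_eq]
  change _ + kron 1 (Z 0) = _
  rw [map_zero, kron_zero, add_zero]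
  rfl

theorem squareFieldB_eq (Z : E →ₗ⋆[ℂ] Module.End ℂ K) (ψ : E) : squareFieldB Z ψ = kron 1 (Z ψ) := by
  rw [squareFieldB, squareField_eq]
  change kron (Z 0) _ + _ = _
  rw [map_zero, zero_kron, zero_add]
  rfl

/-- The doubled field as a conjugate linear map. -/
def squareFieldₗ (Z : E →ₗ⋆[ℂ] Module.End ℂ K) :
    WithLp 2 (E × E) →ₗ⋆[ℂ] Module.End ℂ (TensorSquare K) where
  toFun := squareField Z
  map_add' ξ η := by
    simp only [squareField_eq, WithLp.add_fst, WithLp.add_snd, map_add, add_kron, kron_add]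
    abel
  map_smul' c ξ := by
    simp only [squareField_eq, WithLp.smul_fst, WithLp.smul_snd, map_smulₛₗ, smul_kron, kron_smul,
      smul_add]

theorem IsCAR.doubled (hZ : IsCAR Z) : IsCAR (squareFieldₗ Z) := by
  have hW := hZ.parity_mul_parity
  refine ⟨fun ξ η => ?_, fun ξ η => ?_⟩
  · change squareField Z ξ * star (squareField Z η) + star (squareField Z η) * squareField Z ξ
      = _
    simp only [squareField_eq, star_add, star_kron, hZ.star_parity, star_one, mul_add, add_mul,
      kron_mul, hW, one_mul, mul_one]
    have e1 := hZ.car ξ.fst η.fst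
    have e2 := hZ.car ξ.snd η.snd
    calc _ = kron (Z ξ.fst * star (Z η.fst) + star (Z η.fst) * Z ξ.fst) 1 +
          kron 1 (Z ξ.snd * star (Z η.snd) + star (Z η.snd) * Z ξ.snd) := by
          rw [hZ.mul_parity, hZ.star_mul_parity, kron_neg, kron_neg, add_kron, kron_add]
          abel
      _ = _ := by
          rw [e1, e2, smul_kron, kron_smul, kron_one, ← add_smul]
          rfl
  · change squareField Z ξ * squareField Z η + squareField Z η * squareField Z ξ = _
    simp only [squareField_eq, mul_add, add_mul, kron_mul, hW, one_mul, mul_one]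
    calc _ = kron (Z ξ.fst * Z η.fst + Z η.fst * Z ξ.fst) 1 +
          kron 1 (Z ξ.snd * Z η.snd + Z η.snd * Z ξ.snd) := by
          rw [hZ.mul_parity, hZ.mul_parity, kron_neg, kron_neg, add_kron, kron_add]
          abel
      _ = _ := by rw [hZ.car_ann, hZ.car_ann, kron_zero, zero_kron, add_zero]

/-- The symmetry `1 ⊗ (1 + W)/2 + W ⊗ (1 - W)/2`, which conjugates `Z ⊗ 1` to `Z ⊗ W`. -/
def parityTwist (Z : E → Module.End ℂ K) : Module.End ℂ (TensorSquare K) :=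
  kron 1 ((1 / 2 : ℂ) • (1 + parity Z)) + kron (parity Z) ((1 / 2 : ℂ) • (1 - parity Z))

theorem IsCAR.star_parityTwist (hZ : IsCAR Z) : star (parityTwist Z) = parityTwist Z := by
  simp [parityTwist, star_kron, hZ.star_parity]

theorem IsCAR.parityTwist_mul_self (hZ : IsCAR Z) : parityTwist Z * parityTwist Z = 1 := by
  have hW := hZ.parity_mul_parity
  simp only [parityTwist, kron_smul, kron_add, kron_sub, mul_add, add_mul, mul_sub, sub_mul,
    smul_add, smul_sub, smul_mul_assoc, mul_smul_comm, kron_mul, hW, one_mul, mul_one, kron_one]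
  module

theorem IsCAR.parityTwist_conj (hZ : IsCAR Z) (ψ : E) :
    parityTwist Z * kron (Z ψ) 1 * parityTwist Z = kron (Z ψ) (parity Z) := by
  have hW := hZ.parity_mul_parity
  simp only [parityTwist, kron_smul, kron_add, kron_sub, mul_add, add_mul, mul_sub, sub_mul,
    smul_add, smul_sub, smul_mul_assoc, mul_smul_comm, kron_mul, hW, one_mul, mul_one,
    hZ.parity_mul, neg_mul, mul_assoc, neg_kron]
  module

/-- On even operators ι_A is plain X ↦ X ⊗ 1; since ρ_T is even, ι_A(ρ_T) ι_B(X) is simply ρ_T ⊗ X.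
-/
theorem parityTwist_conj_even {X : Module.End ℂ K} (hZ : IsCAR Z) (hX : Commute (parity Z) X) :
    parityTwist Z * kron X 1 * parityTwist Z = kron X 1 := by
  have : parityTwist Z * kron X 1 = kron X 1 * parityTwist Z := by
    simp only [parityTwist, mul_add, add_mul, kron_mul, one_mul, mul_one, hX.eq]
  rw [this, mul_assoc, hZ.parityTwist_mul_self, mul_one]

/-- The embedding `ι_A` of the operators on `K`, with `Z(ψ) ↦ Z(ψ ⊕ 0)`. -/
def embedA (hZ : IsCAR Z) : Module.End ℂ K →⋆ₐ[ℂ] Module.End ℂ (TensorSquare K) where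
  toFun X := parityTwist Z * kron X 1 * parityTwist Z
  map_one' := by rw [kron_one, mul_one, hZ.parityTwist_mul_self]
  map_mul' X Y := by
    have : kron (X * Y) 1 = kron X 1 * (parityTwist Z * parityTwist Z) * kron Y 1 := by
      rw [hZ.parityTwist_mul_self, mul_one, kron_mul, one_mul]
    rw [this]
    simp only [mul_assoc]
  map_zero' := by rw [zero_kron, mul_zero, zero_mul]
  map_add' X Y := by rw [add_kron, mul_add, add_mul]
  commutes' c := by
    rw [Algebra.algebraMap_eq_smul_one, Algebra.algebraMap_eq_smul_one, smul_kron, kron_one,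
      mul_smul_comm, mul_one, smul_mul_assoc, hZ.parityTwist_mul_self]
  map_star' X := by
    rw [star_mul, star_mul, hZ.star_parityTwist, star_kron, star_one, mul_assoc]

/-- The embedding `ι_B` of the operators on `K`, with `Z(ψ) ↦ Z(0 ⊕ ψ)`. -/
def embedB : Module.End ℂ K →⋆ₐ[ℂ] Module.End ℂ (TensorSquare K) where
  toFun X := kron 1 X
  map_one' := kron_one
  map_mul' X Y := by rw [kron_mul, one_mul]
  map_zero' := kron_zero _
  map_add' X Y := kron_add _ _ _
  commutes' c := by
    rw [Algebra.algebraMap_eq_smul_one, Algebra.algebraMap_eq_smul_one, kron_smul, kron_one]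
  map_star' X := by rw [star_kron, star_one]

theorem embedA_field (hZ : IsCAR Z) (ψ : E) : embedA hZ (Z ψ) = squareFieldA Z ψ := by
  rw [squareFieldA_eq]
  exact hZ.parityTwist_conj ψ

theorem embedB_field (ψ : E) : embedB (Z ψ) = squareFieldB Z ψ := (squareFieldB_eq Z ψ).symm

theorem tau_embedA [Nontrivial K] (hZ : IsCAR Z) (X : Module.End ℂ K) :
    tau (embedA hZ X) = tau X := by
  change tau (parityTwist Z * kron X 1 * parityTwist Z) = _
  rw [tau_mul_comm, ← mul_assoc, hZ.parityTwist_mul_self, one_mul, tau_kron, tau_one, mul_one]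

theorem carHom_apply {V : Type*} {Y : V → Module.End ℂ K} (htop : carAlgebra Y = ⊤)
    {L : Type*} [NormedAddCommGroup L] [InnerProductSpace ℂ L] [FiniteDimensional ℂ L]
    {Y' : V → Module.End ℂ L} (f : Module.End ℂ K →⋆ₐ[ℂ] Module.End ℂ L)
    (hf : ∀ ξ, f (Y ξ) = Y' ξ) (X : Module.End ℂ K) : carHom Y Y' X = f X := by
  have h : ∃ f : Module.End ℂ K →⋆ₐ[ℂ] Module.End ℂ L, ∀ ξ, f (Y ξ) = Y' ξ := ⟨f, hf⟩
  have e : h.choose = f := StarAlgHom.ext_of_adjoin_eq_top htop (by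
    rintro _ ⟨ξ, rfl⟩
    exact (h.choose_spec ξ).trans (hf ξ).symm)
  rw [carHom, dif_pos h, e]
  rfl

theorem carAlgebra_fieldA (hZ : IsCAR Z) (htop : carAlgebra Z = ⊤) :
    carAlgebra (squareFieldA Z) = (embedA hZ).range := by
  have h1 : (embedA hZ).range = (carAlgebra Z).map (embedA hZ) := by
    rw [htop, StarAlgHom.range_eq_map_top]
  rw [h1, carAlgebra, carAlgebra, StarAlgHom.map_adjoin, ← Set.range_comp]
  congr 1
  ext x
  simp [embedA_field]

theorem carAlgebra_doubled (hZ : IsCAR Z) (htop : carAlgebra Z = ⊤) :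
    carAlgebra (squareFieldₗ Z) = ⊤ := by
  set A := carAlgebra (squareFieldₗ Z) with hA
  have hmem : ∀ ξ, squareField Z ξ ∈ A := fun ξ => StarAlgebra.subset_adjoin ℂ _ ⟨ξ, rfl⟩
  have h1 : ∀ X, embedA hZ X ∈ A := fun X => by
    have hX : X ∈ carAlgebra Z := htop ▸ trivial
    have hle : carAlgebra Z ≤ A.comap (embedA hZ) := by
      refine StarAlgebra.adjoin_le ?_
      rintro _ ⟨ψ, rfl⟩
      change embedA hZ (Z ψ) ∈ A
      rw [embedA_field]
      exact hmem _
    exact hle hX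
  have h2 : ∀ X, kron 1 X ∈ A := fun X => by
    have hX : X ∈ carAlgebra Z := htop ▸ trivial
    have hle : carAlgebra Z ≤ A.comap (embedB (K := K)) := by
      refine StarAlgebra.adjoin_le ?_
      rintro _ ⟨ψ, rfl⟩
      change embedB (Z ψ) ∈ A
      rw [embedB_field]
      exact hmem _
    exact hle hX
  have h3 : kron (parity Z) 1 ∈ A := by
    have := h1 (parity Z)
    rwa [show embedA hZ (parity Z) = kron (parity Z) 1 from
      parityTwist_conj_even hZ (Commute.refl _)] at this
  -- The twist is itself generated by the fields, because W ⊗ 1 = ι_A(W) and all 1 ⊗ X are. Undoing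
  -- it recovers X ⊗ 1 from ι_A(X), hence every X ⊗ Y.
  have h4 : parityTwist Z ∈ A := by
    refine add_mem (h2 _) ?_
    have := mul_mem h3 (h2 ((1 / 2 : ℂ) • (1 - parity Z)))
    rwa [kron_mul, one_mul, mul_one] at this
  have h5 : ∀ X Y, kron X Y ∈ A := fun X Y => by
    have e : kron X Y =
        parityTwist Z * (parityTwist Z * kron X 1 * parityTwist Z) * parityTwist Z * kron 1 Y := by
      rw [← mul_assoc, ← mul_assoc, hZ.parityTwist_mul_self, one_mul, mul_assoc (kron X 1),
        hZ.parityTwist_mul_self, mul_one, kron_mul, one_mul, mul_one]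
    rw [e]
    exact mul_mem (mul_mem (mul_mem h4 (h1 X)) h4) (h2 Y)
  refine eq_top_iff.2 fun X _ => ?_
  have hX : X ∈ Submodule.span ℂ
      (Set.range fun p : Module.End ℂ K × Module.End ℂ K => kron p.1 p.2) :=
    by rw [span_kron_eq_top]; exact trivial
  induction hX using Submodule.span_induction with
  | mem x hx => obtain ⟨p, rfl⟩ := hx; exact h5 _ _
  | zero => exact zero_mem _
  | add x y _ _ hx hy => exact add_mem (hx trivial) (hy trivial)
  | smul c x _ hx => exact SMulMemClass.smul_mem c (hx trivial)

variable [CompleteSpace E]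

theorem exists_dilation_hom [Nontrivial K] (hZ : IsCAR Z) (htop : carAlgebra Z = ⊤) {S : E →L[ℂ] E}
    (hS : ∀ ξ η, inner ℂ (dilation S ξ) (dilation S η) = inner ℂ ξ η) :
    ∃ f : Module.End ℂ (TensorSquare K) →⋆ₐ[ℂ] Module.End ℂ (TensorSquare K),
      (∀ ξ, f (squareField Z ξ) = squareField Z (dilation S ξ)) ∧
        ∀ X, carHom (squareField Z) (fun ξ => squareField Z (dilation S ξ)) X = f X := by
  let D : WithLp 2 (E × E) →ₗ[ℂ] WithLp 2 (E × E) :=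
    { toFun := dilation S
      map_add' := fun ξ η => by
        refine (WithLp.ofLp_injective 2) (Prod.ext ?_ ?_)
        · simp [dilation]; abel
        · simp [dilation]; abel
      map_smul' := fun c ξ => by
        refine (WithLp.ofLp_injective 2) (Prod.ext ?_ ?_) <;> simp [dilation] }
  let Y := (squareFieldₗ Z).comp D
  have hY : IsCAR Y := ⟨fun ξ η => (hZ.doubled.car _ _).trans (by rw [← hS ξ η]; rfl),
    fun ξ η => hZ.doubled.car_ann _ _⟩
  obtain ⟨f, hf⟩ := exists_starAlgHom hZ.doubled (carAlgebra_doubled hZ htop) hY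
  exact ⟨f, hf, fun X => carHom_apply (carAlgebra_doubled hZ htop) f hf X⟩

omit [CompleteSpace E] in
-- The expectation is ι_A composed with its own trace adjoint, which works because ι_A is
-- multiplicative and preserves the trace.
theorem isTracialCondExp_tracialCondExp [Nontrivial K] (hZ : IsCAR Z) (htop : carAlgebra Z = ⊤) :
    IsTracialCondExp (carAlgebra (squareFieldA Z)) (tracialCondExp (carAlgebra (squareFieldA Z))) := by
  have h : ∃ F, IsTracialCondExp (carAlgebra (squareFieldA Z)) F := by
    obtain ⟨g, hg⟩ := exists_tau_adjoint (embedA hZ).toLinearMap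
    refine ⟨(embedA hZ).toLinearMap ∘ₗ g, fun X => ?_⟩
    rw [carAlgebra_fieldA hZ htop]
    refine ⟨⟨g X, rfl⟩, ?_⟩
    rintro _ ⟨B, rfl⟩
    change tau (embedA hZ B * embedA hZ (g X)) = tau (embedA hZ B * X)
    have := congrArg star (hg X (star B))
    rw [← tau_star, ← tau_star, star_mul, star_mul, star_star, star_star, star_star] at this
    rw [← map_mul, tau_embedA, this]
    change tau (star (embedA hZ (star B)) * X) = _
    rw [← map_star, star_star]
  rw [tracialCondExp, dif_pos h]
  exact h.choose_spec

/-- The Hilbert-Schmidt pairing of the Evans-Hugenholtz-Kadison map. -/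
theorem tau_star_mul_ehkMap [Nontrivial K] (hZ : IsCAR Z) (htop : carAlgebra Z = ⊤)
    {S R : E →L[ℂ] E} (f : Module.End ℂ (TensorSquare K) →⋆ₐ[ℂ] Module.End ℂ (TensorSquare K))
    (hf : ∀ X, carHom (squareField Z) (fun ξ => squareField Z (dilation S ξ)) X = f X)
    (heven : Commute (parity Z) (gigDensity Z (ancillaSymbol S R))) (X Y : Module.End ℂ K) :
    tau (star Y * ehkMap Z S R X) =
      tau (star (f (embedA hZ Y)) * kron (gigDensity Z (ancillaSymbol S R)) X) := by
  set ρ := gigDensity Z (ancillaSymbol S R)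
  have hA : ∀ X, carHom Z (squareFieldA Z) X = embedA hZ X := carHom_apply htop _ (embedA_field hZ)
  have hB : ∀ X, carHom Z (squareFieldB Z) X = embedB X := carHom_apply htop _ embedB_field
  -- `leftInverse` is a genuine left inverse only for an injective map; ι_A is injective because it
  -- preserves a faithful trace.
  have hker : LinearMap.ker (carHom Z (squareFieldA Z)) = ⊥ := by
    rw [LinearMap.ker_eq_bot']
    intro X hX
    rw [hA] at hX
    refine eq_zero_of_tau_star_mul_self ?_
    rw [← tau_embedA hZ, map_mul, hX, mul_zero, tau_zero]
  set g := hsAdjoint (carHom (squareField Z) fun ξ => squareField Z (dilation S ξ)) (kron ρ X) with hg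
  obtain ⟨hmem, hexp⟩ := isTracialCondExp_tracialCondExp hZ htop g
  have hΦ : ehkMap Z S R X = (carHom Z (squareFieldA Z)).leftInverse
      (tracialCondExp (carAlgebra (squareFieldA Z)) g) := by
    have e : carHom Z (squareFieldA Z) ρ * carHom Z (squareFieldB Z) X = kron ρ X := by
      rw [hA, hB]
      change parityTwist Z * kron ρ 1 * parityTwist Z * kron 1 X = _
      rw [parityTwist_conj_even hZ heven, kron_mul, mul_one, one_mul]
    rw [hg, ← e]
    rfl
  have hmem2 := (carAlgebra_fieldA hZ htop).le hmem
  obtain ⟨Q, hQ⟩ := hmem2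
  change embedA hZ Q = _ at hQ
  -- Transporting the pairing by ι_A cancels the inverse, and the expectation disappears because the
  -- test operator lies in the algebra of A.
  rw [hΦ, ← hQ, ← hA, LinearMap.leftInverse_apply_of_inj hker, ← tau_embedA hZ, map_mul, hQ,
    hexp _ (by rw [carAlgebra_fieldA hZ htop]; exact ⟨_, rfl⟩)]
  have := congrArg star (hsAdjoint_spec (carHom (squareField Z) fun ξ => squareField Z (dilation S ξ)) (kron ρ X) (embedA hZ Y))
  rwa [← tau_star, ← tau_star, star_mul, star_mul, star_star, star_star, ← map_star, hf] at this

end Doubling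

/-! ### Hermite operators under the dilation -/

section Dilated

variable {E : Type*} [NormedAddCommGroup E] [InnerProductSpace ℂ E] [FiniteDimensional ℂ E]
variable {K : Type*} [NormedAddCommGroup K] [InnerProductSpace ℂ K] [FiniteDimensional ℂ K]
variable {Z : E →ₗ⋆[ℂ] Module.End ℂ K}

/-- The operators on `K ⊗ K` spanned by the tensor products `P ⊗ Y` with `P ∈ C`. -/
def kronSpan (C : Subalgebra ℂ (Module.End ℂ K)) :
    Submodule ℂ (Module.End ℂ (TensorSquare K)) :=
  Submodule.span ℂ {x | ∃ P ∈ C, ∃ Y, kron P Y = x}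

omit [FiniteDimensional ℂ K] in
theorem kronSpan_mul_mem (C : Subalgebra ℂ (Module.End ℂ K))
    {x y : Module.End ℂ (TensorSquare K)} (hx : x ∈ kronSpan C) (hy : y ∈ kronSpan C) :
    x * y ∈ kronSpan C := by
  have := Submodule.mul_mem_mul hx hy
  rw [kronSpan, Submodule.span_mul_span] at this
  refine Submodule.span_mono ?_ this
  rintro _ ⟨_, ⟨P, hP, Y, rfl⟩, _, ⟨P', hP', Y', rfl⟩, rfl⟩
  exact ⟨P * P', mul_mem hP hP', Y * Y', (kron_mul _ _ _ _).symm⟩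

/-- The image of a mode under the dilation. -/
def dilatedMode (Z : E → Module.End ℂ K) (ψ : E) (c s : ℝ) : Module.End ℂ (TensorSquare K) :=
  (s : ℂ) • kron 1 (Z ψ) - (c : ℂ) • kron (Z ψ) (parity Z)

theorem IsCAR.star_dilatedMode (hZ : IsCAR Z) (ψ : E) (c s : ℝ) : star (dilatedMode Z ψ c s) =
    (s : ℂ) • kron 1 (star (Z ψ)) - (c : ℂ) • kron (star (Z ψ)) (parity Z) := by
  simp only [dilatedMode, star_sub, star_smul, star_kron, star_one, hZ.star_parity,
    Complex.star_def, Complex.conj_ofReal]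

theorem IsCAR.dilatedMode_mem (hZ : IsCAR Z) {ψ : E} {C : Subalgebra ℂ (Module.End ℂ K)}
    (h : Z ψ ∈ C) (h' : star (Z ψ) ∈ C) (c s : ℝ) :
    dilatedMode Z ψ c s ∈ kronSpan C ∧ star (dilatedMode Z ψ c s) ∈ kronSpan C := by
  rw [hZ.star_dilatedMode]
  have hk : ∀ P ∈ C, ∀ Y, kron P Y ∈ kronSpan C := fun P hP Y =>
    Submodule.subset_span ⟨P, hP, Y, rfl⟩
  exact ⟨sub_mem (Submodule.smul_mem _ _ (hk _ (one_mem _) _)) (Submodule.smul_mem _ _ (hk _ h _)),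
    sub_mem (Submodule.smul_mem _ _ (hk _ (one_mem _) _)) (Submodule.smul_mem _ _ (hk _ h' _))⟩

theorem modeProd_mem_kronSpan (C : Subalgebra ℂ (Module.End ℂ K)) {N : ℕ}
    {z : Fin N → Module.End ℂ (TensorSquare K)} (h : ∀ j, z j ∈ kronSpan C)
    (h' : ∀ j, star (z j) ∈ kronSpan C) (μ : Fin N → ℝ) (α : Fin N → Fin 2 × Fin 2) :
    modeProd z μ α ∈ kronSpan C := by
  have h1 : (1 : Module.End ℂ (TensorSquare K)) ∈ kronSpan C :=
    Submodule.subset_span ⟨1, one_mem _, 1, kron_one⟩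
  let A : Subalgebra ℂ (Module.End ℂ (TensorSquare K)) :=
    (kronSpan C).toSubalgebra h1 fun x y hx hy => kronSpan_mul_mem C hx hy
  exact modeProd_mem A h h' μ α

/-- Up to terms with a nontrivial factor on the first tensor component, the dilation contracts the
operators of one mode. -/
theorem IsCAR.modeOp_dilatedMode (hZ : IsCAR Z) (ψ : E) {c s : ℝ} (hcs : c ^ 2 + s ^ 2 = 1) (m : ℝ)
    (a : Fin 2 × Fin 2) : modeOp (dilatedMode Z ψ c s) m a -
      ((s ^ ((a.1 : ℕ) + (a.2 : ℕ)) : ℝ) : ℂ) • kron 1 (modeOp (Z ψ) m a) ∈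
      Submodule.span ℂ {x | ∃ d : Fin 2 × Fin 2, d ≠ (0, 0) ∧ ∃ Y, kron (modeOp (Z ψ) m d) Y = x} := by
  set J := Submodule.span ℂ
    {x | ∃ d : Fin 2 × Fin 2, d ≠ (0, 0) ∧ ∃ Y, kron (modeOp (Z ψ) m d) Y = x}
  have hJ : ∀ d : Fin 2 × Fin 2, d ≠ (0, 0) → ∀ Y, kron (modeOp (Z ψ) m d) Y ∈ J :=
    fun d hd Y => Submodule.subset_span ⟨d, hd, Y, rfl⟩
  have h10 : ∀ Y, kron (star (Z ψ)) Y ∈ J := hJ (1, 0) (by simp)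
  have h01 : ∀ Y, kron (Z ψ) Y ∈ J := hJ (0, 1) (by simp)
  have h11 := hJ (1, 1) (by simp)
  have hs := hZ.star_dilatedMode ψ c s
  fin_cases a
  · simp [modeOp, kron_one]
  · have : dilatedMode Z ψ c s - ((s ^ (0 + 1) : ℝ) : ℂ) • kron 1 (Z ψ) =
        -((c : ℂ) • kron (Z ψ) (parity Z)) := by
      rw [dilatedMode, zero_add, pow_one]; abel
    have hm := J.neg_mem (J.smul_mem (c : ℂ) (h01 (parity Z)))
    rw [← this] at hm
    exact hm
  · have : star (dilatedMode Z ψ c s) - ((s ^ (1 + 0) : ℝ) : ℂ) • kron 1 (star (Z ψ)) =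
        -((c : ℂ) • kron (star (Z ψ)) (parity Z)) := by
      rw [hs, add_zero, pow_one]; abel
    have hm := J.neg_mem (J.smul_mem (c : ℂ) (h10 (parity Z)))
    rw [← this] at hm
    exact hm
  · have hW := hZ.parity_mul_parity
    have hc : (c : ℂ) ^ 2 = 1 - (s : ℂ) ^ 2 := by
      have : (c : ℂ) ^ 2 + (s : ℂ) ^ 2 = 1 := by exact_mod_cast congrArg (fun x : ℝ => (x : ℂ)) hcs
      linear_combination this
    -- Writing m = s²m + c²m centers the number operators of both legs at m. The cross terms carry Z
    -- or Z* on the first leg.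
    have : star (dilatedMode Z ψ c s) * dilatedMode Z ψ c s - (m : ℂ) • 1 -
        ((s ^ 2 : ℝ) : ℂ) • kron 1 (star (Z ψ) * Z ψ - (m : ℂ) • 1) =
        ((c : ℂ) ^ 2) • kron (star (Z ψ) * Z ψ - (m : ℂ) • 1) 1 -
          ((s : ℂ) * c) • kron (Z ψ) (star (Z ψ) * parity Z) -
          ((s : ℂ) * c) • kron (star (Z ψ)) (parity Z * Z ψ) := by
      rw [hs, dilatedMode]
      simp only [mul_sub, sub_mul, smul_mul_assoc, mul_smul_comm, kron_mul, hW, one_mul, mul_one,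
        sub_kron, smul_kron, kron_sub, kron_smul, kron_one, smul_sub, smul_smul]
      rw [hc]
      push_cast
      match_scalars <;> ring_nf
      exact hc
    have hm := J.sub_mem (J.sub_mem (J.smul_mem ((c : ℂ) ^ 2) (h11 1))
      (J.smul_mem ((s : ℂ) * c) (h01 (star (Z ψ) * parity Z))))
      (J.smul_mem ((s : ℂ) * c) (h10 (parity Z * Z ψ)))
    change ((c : ℂ) ^ 2) • kron (star (Z ψ) * Z ψ - (m : ℂ) • 1) 1 - _ - _ ∈ J at hm
    rw [← this] at hm
    exact hm

/-- Modes are peeled off from the left. The first legs of the remaining modes lie in the graded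
centralizer of the leading one, so every error term contains a vanishing average against ρ. -/
theorem IsKMS.tau_modeProd_dilatedMode {T : E →L[ℂ] E} {ρ : Module.End ℂ K} (hρ : IsKMS Z T ρ)
    (hZ : IsCAR Z) (hone : tau ρ = 1) : ∀ {N : ℕ} {v : Fin N → E} (_ : Orthonormal ℂ v)
    {μ c s : Fin N → ℝ} (_ : ∀ j, T (v j) = (μ j : ℂ) • v j) (_ : ∀ j, c j ^ 2 + s j ^ 2 = 1)
    (α : Fin N → Fin 2 × Fin 2) (X : Module.End ℂ K),
    tau (modeProd (fun j => dilatedMode Z (v j) (c j) (s j)) μ α * kron ρ X) =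
      ((∏ j, s j ^ (((α j).1 : ℕ) + ((α j).2 : ℕ)) : ℝ) : ℂ) *
        tau (modeProd (fun j => Z (v j)) μ α * X)
  | 0, _, _, _, _, _, _, _, _, _ => by simp [modeProd, tau_kron, hone]
  | N + 1, v, hv, μ, c, s, hT, hcs, α, X => by
    have hv' : Orthonormal ℂ fun j : Fin N => v j.succ := hv.comp _ (Fin.succ_injective N)
    have hC : ∀ j : Fin N, Z (v j.succ) ∈ gradedCentralizer Z (v 0) ∧
        star (Z (v j.succ)) ∈ gradedCentralizer Z (v 0) := fun j =>
      hZ.field_mem_gradedCentralizer (hv.2 (Fin.succ_ne_zero j).symm)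
    rw [modeProd_succ, modeProd_succ, Fin.prod_univ_succ]
    set G := modeProd (fun j : Fin N => dilatedMode Z (v j.succ) (c j.succ) (s j.succ))
      (fun j => μ j.succ) fun j => α j.succ with hG
    have hmem : G ∈ kronSpan (gradedCentralizer Z (v 0)) :=
      modeProd_mem_kronSpan _ (fun j => (hZ.dilatedMode_mem (hC j).1 (hC j).2 _ _).1)
        (fun j => (hZ.dilatedMode_mem (hC j).1 (hC j).2 _ _).2) _ _
    have hvan : ∀ x ∈ Submodule.span ℂ {x | ∃ d : Fin 2 × Fin 2, d ≠ (0, 0) ∧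
        ∃ Y, kron (modeOp (Z (v 0)) (μ 0) d) Y = x}, tau (x * G * kron ρ X) = 0 := by
      intro x hx
      induction hx using Submodule.span_induction with
      | zero => rw [zero_mul, zero_mul, tau_zero]
      | add x y _ _ hx hy => rw [add_mul, add_mul, tau_add, hx, hy, add_zero]
      | smul k x _ hx => rw [smul_mul_assoc, smul_mul_assoc, tau_smul, hx, mul_zero]
      | mem x hx =>
        obtain ⟨d, hd, Y, rfl⟩ := hx
        clear_value G
        clear hG
        induction hmem using Submodule.span_induction with
        | zero => rw [mul_zero, zero_mul, tau_zero]
        | add x y _ _ hx hy => rw [mul_add, add_mul, tau_add, hx, hy, add_zero]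
        | smul k x _ hx => rw [mul_smul_comm, smul_mul_assoc, tau_smul, hx, mul_zero]
        | mem x hx =>
          obtain ⟨P, hP, Y', rfl⟩ := hx
          rw [kron_mul, kron_mul, tau_kron, hρ.tau_modeOp_mul hZ (hv.1 0) (hT 0) hP hd, zero_mul]
    have h0 := hvan _ (hZ.modeOp_dilatedMode (v 0) (hcs 0) (μ 0) (α 0))
    rw [sub_mul, sub_mul, tau_sub, sub_eq_zero] at h0
    -- The surviving 1 ⊗ H goes around the trace and is absorbed in the second leg; hence the
    -- induction over arbitrary `X`.
    have ih := hρ.tau_modeProd_dilatedMode hZ hone hv' (fun j => hT j.succ) (fun j => hcs j.succ)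
      (fun j => α j.succ) (X * modeOp (Z (v 0)) (μ 0) (α 0))
    rw [h0, smul_mul_assoc, smul_mul_assoc, tau_smul, mul_assoc (kron _ _), tau_mul_comm (kron _ _),
      mul_assoc, kron_mul, mul_one, ih, ← mul_assoc (modeProd _ _ _) X,
      tau_mul_comm _ (modeOp _ _ _), ← mul_assoc (modeOp _ _ _)]
    push_cast
    ring

end Dilated

/-! ### Operators diagonal in an orthonormal basis -/

section Diagonal

variable {E : Type*} [NormedAddCommGroup E] [InnerProductSpace ℂ E] [FiniteDimensional ℂ E]

/-- A commuting pair of symmetric operators has an orthonormal basis of joint eigenvectors. -/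
theorem exists_joint_eigenbasis {A B : E →ₗ[ℂ] E} (hA : A.IsSymmetric) (hB : B.IsSymmetric)
    (hAB : Commute A B) : ∃ (N : ℕ) (b : OrthonormalBasis (Fin N) ℂ E) (l μ : Fin N → ℝ),
      (∀ j, A (b j) = (l j : ℂ) • b j) ∧ ∀ j, B (b j) = (μ j : ℂ) • b j := by
  classical
  have hV := hA.direct_sum_isInternal
  have hV' : OrthogonalFamily ℂ (fun γ : Module.End.Eigenvalues A => Module.End.eigenspace A γ)
      fun γ => (Module.End.eigenspace A γ).subtypeₗᵢ := hA.orthogonalFamily_eigenspaces'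
  have hinv : ∀ γ : ℂ, ∀ v ∈ Module.End.eigenspace A γ, B v ∈ Module.End.eigenspace A γ :=
    fun γ => Module.End.mapsTo_genEigenspace_of_comm hAB γ 1
  have hsymm := fun γ : ℂ => hB.restrict_invariant (hinv γ)
  let b := hV.collectedOrthonormalBasis hV' fun γ => (hsymm γ).eigenvectorBasis rfl
  have hb : ∀ i, b i = ((hsymm i.1).eigenvectorBasis rfl i.2 : E) := fun i => by
    simp [b, DirectSum.IsInternal.collectedOrthonormalBasis]
  have hBb : ∀ i, B (b i) = (((hsymm i.1).eigenvalues rfl i.2 : ℝ) : ℂ) • b i := fun i => by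
    have := congrArg (Subtype.val) ((hsymm i.1).apply_eigenvectorBasis rfl i.2)
    rw [hb]
    exact this
  have hAb : ∀ i, ∃ l : ℝ, A (b i) = (l : ℂ) • b i := fun i => by
    have h1 : A (b i) = (i.1 : ℂ) • b i := by
      rw [hb]
      exact Module.End.mem_eigenspace_iff.1 ((hsymm i.1).eigenvectorBasis rfl i.2).2
    have h2 := hA.conj_eigenvalue_eq_self i.1.2
    refine ⟨(i.1 : ℂ).re, ?_⟩
    rw [h1]
    exact congrArg (fun c : ℂ => c • b i) (Complex.conj_eq_iff_re.1 h2).symm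
  choose l hl using hAb
  let e := Fintype.equivFin (Σ γ : Module.End.Eigenvalues A,
    Fin (Module.finrank ℂ (Module.End.eigenspace A (γ : ℂ))))
  refine ⟨_, b.reindex e, fun j => l (e.symm j),
    fun j => (hsymm (e.symm j).1).eigenvalues rfl (e.symm j).2, fun j => ?_, fun j => ?_⟩
  · rw [OrthonormalBasis.reindex_apply]
    exact hl _
  · rw [OrthonormalBasis.reindex_apply]
    exact hBb _

variable {ι : Type*} [Fintype ι] (b : OrthonormalBasis ι ℂ E)

omit [FiniteDimensional ℂ E] in
theorem ext_orthonormalBasis {A B : E →L[ℂ] E} (h : ∀ j, A (b j) = B (b j)) : A = B := by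
  refine ContinuousLinearMap.coe_injective (b.toBasis.ext fun j => ?_)
  simpa using h j

/-- The operator that is diagonal in an orthonormal basis, with given real eigenvalues. -/
def diagonalOp (a : ι → ℝ) : E →L[ℂ] E :=
  LinearMap.toContinuousLinearMap (b.toBasis.constr ℂ fun j => (a j : ℂ) • b j)

theorem diagonalOp_apply (a : ι → ℝ) (j : ι) : diagonalOp b a (b j) = (a j : ℂ) • b j := by
  have := b.toBasis.constr_basis ℂ (fun j => (a j : ℂ) • b j) j
  rw [b.coe_toBasis] at this
  exact this

variable {b} [CompleteSpace E]

omit [FiniteDimensional ℂ E] in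
theorem star_eq_self_of_apply_basis {A : E →L[ℂ] E} {a : ι → ℝ}
    (h : ∀ j, A (b j) = (a j : ℂ) • b j) : star A = A := by
  classical
  refine ext_orthonormalBasis b fun j => InnerProductSpace.ext_inner_left_basis b.toBasis fun i => ?_
  rw [b.coe_toBasis, ContinuousLinearMap.star_eq_adjoint, ContinuousLinearMap.adjoint_inner_right,
    h, h, inner_smul_left, inner_smul_right, orthonormal_iff_ite.1 b.orthonormal, Complex.conj_ofReal]
  split_ifs with hij
  · rw [hij]
  · simp

theorem nonneg_iff_of_apply_basis {A : E →L[ℂ] E} {a : ι → ℝ}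
    (h : ∀ j, A (b j) = (a j : ℂ) • b j) : 0 ≤ A ↔ ∀ j, 0 ≤ a j := by
  constructor
  · intro hA j
    have := ((ContinuousLinearMap.nonneg_iff_isPositive A).1 hA).re_inner_nonneg_right (b j)
    rw [h, inner_smul_right, inner_self_eq_norm_sq_to_K, b.orthonormal.1 j] at this
    simpa using this
  · intro ha
    have hB := diagonalOp_apply b fun j => √(a j)
    have : A = star (diagonalOp b fun j => √(a j)) * diagonalOp b fun j => √(a j) := by
      refine ext_orthonormalBasis b fun j => ?_
      rw [star_eq_self_of_apply_basis hB, mul_apply_eq_comp, hB, map_smul, hB, h,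
        smul_smul, ← Complex.ofReal_mul, Real.mul_self_sqrt (ha j)]
    rw [this]
    exact star_mul_self_nonneg _

theorem sqrt_apply_basis {A : E →L[ℂ] E} {a : ι → ℝ} (h : ∀ j, A (b j) = (a j : ℂ) • b j)
    (ha : ∀ j, 0 ≤ a j) (j : ι) : CFC.sqrt A (b j) = ((√(a j) : ℝ) : ℂ) • b j := by
  have hB := diagonalOp_apply b fun j => √(a j)
  rw [CFC.sqrt_unique (b := diagonalOp b fun j => √(a j)) ?_
    ((nonneg_iff_of_apply_basis hB).2 fun j => Real.sqrt_nonneg _), hB]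
  refine ext_orthonormalBasis b fun j => ?_
  rw [mul_apply_eq_comp, hB, map_smul, hB, h, smul_smul, ← Complex.ofReal_mul,
    Real.mul_self_sqrt (ha j)]

omit [FiniteDimensional ℂ E] in
theorem exp_apply_of_eigenvector {A : E →L[ℂ] E} {v : E} {a : ℝ} (h : A v = (a : ℂ) • v) :
    NormedSpace.exp A v = ((Real.exp a : ℝ) : ℂ) • v := by
  have hpow : ∀ n : ℕ, (A ^ n) v = ((a : ℂ) ^ n) • v := fun n => by
    induction n with
    | zero => simp
    | succ n ih => rw [pow_succ, mul_apply_eq_comp, h, map_smul, ih, smul_smul, pow_succ,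
        mul_comm]
  have h1 := (NormedSpace.exp_series_hasSum_exp' (𝕂 := ℂ) A).mapL
    (ContinuousLinearMap.apply ℂ E v)
  have h2 := (NormedSpace.exp_series_hasSum_exp' (𝕂 := ℂ) (a : ℂ)).smul_const v
  rw [← Complex.exp_eq_exp_ℂ] at h2
  rw [Complex.ofReal_exp]
  refine HasSum.unique h1 ?_
  convert h2 using 2 with n
  simp [hpow, smul_smul]

end Diagonal

/-! ### The contraction `exp (-H)` -/

section Contraction

variable {E : Type*} [NormedAddCommGroup E] [InnerProductSpace ℂ E] [FiniteDimensional ℂ E]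
  [CompleteSpace E]
variable {ι : Type*} [Fintype ι] {b : OrthonormalBasis ι ℂ E} {S : E →L[ℂ] E} {s : ι → ℝ}

omit [FiniteDimensional ℂ E] in
/-- The defect operator `1 - S S*` of a diagonal contraction. -/
theorem defect_apply_basis (hS : ∀ j, S (b j) = (s j : ℂ) • b j) (j : ι) :
    (1 - S * star S) (b j) = ((1 - s j ^ 2 : ℝ) : ℂ) • b j := by
  rw [star_eq_self_of_apply_basis hS, sub_apply, mul_apply_eq_comp, hS, map_smul, hS,
    one_apply_eq_self]
  push_cast
  module

theorem sqrt_defect_apply_basis (hS : ∀ j, S (b j) = (s j : ℂ) • b j) (hs : ∀ j, s j ^ 2 ≤ 1)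
    (j : ι) : CFC.sqrt (1 - S * star S) (b j) = ((√(1 - s j ^ 2) : ℝ) : ℂ) • b j :=
  sqrt_apply_basis (defect_apply_basis hS) (fun j => sub_nonneg.2 (hs j)) j

theorem inner_dilation (hS : ∀ j, S (b j) = (s j : ℂ) • b j) (hs : ∀ j, s j ^ 2 ≤ 1)
    (ξ η : WithLp 2 (E × E)) : inner ℂ (dilation S ξ) (dilation S η) = inner ℂ ξ η := by
  have hSS := star_eq_self_of_apply_basis hS
  have hC := sqrt_defect_apply_basis hS hs
  rw [hSS] at hC
  simp only [dilation, hSS]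
  set C := CFC.sqrt (1 - S * S) with hCdef
  have hCC := star_eq_self_of_apply_basis hC
  have e1 : C * C = 1 - S * S := ext_orthonormalBasis b fun j => by
    rw [mul_apply_eq_comp, hC, map_smul, hC, smul_smul, ← Complex.ofReal_mul,
      Real.mul_self_sqrt (sub_nonneg.2 (hs j)), ← defect_apply_basis hS j, hSS]
  have e2 : C * S = S * C := ext_orthonormalBasis b fun j => by
    rw [mul_apply_eq_comp, mul_apply_eq_comp, hC, map_smul, hS, map_smul, hC, smul_smul,
      smul_smul, mul_comm]
  have a1 : ∀ x y, inner ℂ (S x) y = inner ℂ x (S y) := fun x y => by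
    nth_rw 1 [← hSS]
    rw [ContinuousLinearMap.star_eq_adjoint, ContinuousLinearMap.adjoint_inner_left]
  have a2 : ∀ x y, inner ℂ (C x) y = inner ℂ x (C y) := fun x y => by
    nth_rw 1 [← hCC]
    rw [ContinuousLinearMap.star_eq_adjoint, ContinuousLinearMap.adjoint_inner_left]
  have e1' : ∀ x, C (C x) = x - S (S x) := fun x => DFunLike.congr_fun e1 x
  have e2' : ∀ x, C (S x) = S (C x) := fun x => DFunLike.congr_fun e2 x
  rw [WithLp.prod_inner_apply, WithLp.prod_inner_apply]
  change _ = inner ℂ ξ.fst η.fst + inner ℂ ξ.snd η.snd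
  simp only [inner_add_left, inner_add_right, inner_neg_left, inner_neg_right, a1, a2, e1', e2',
    inner_sub_right]
  ring

end Contraction

/-! ### Eigenvalues of the exponentials of `H`. -/

section Exponential

variable {E : Type*} [NormedAddCommGroup E] [InnerProductSpace ℂ E]
variable {ι : Type*} {b : ι → E} {T H : E →L[ℂ] E} {l μ : ι → ℝ}

theorem exp_neg_apply_basis [CompleteSpace E] (hH : ∀ j, H (b j) = (l j : ℂ) • b j) (j : ι) :
    NormedSpace.exp (-H) (b j) = ((Real.exp (-l j) : ℝ) : ℂ) • b j :=
  exp_apply_of_eigenvector (by rw [neg_apply, hH]; push_cast; module)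

theorem one_sub_exp_mul_apply_basis [CompleteSpace E] (hH : ∀ j, H (b j) = (l j : ℂ) • b j)
    (hT : ∀ j, T (b j) = (μ j : ℂ) • b j) (j : ι) :
    ((1 - NormedSpace.exp (-((2 : ℂ) • H))) * T) (b j) =
      (((1 - Real.exp (-l j) ^ 2) * μ j : ℝ) : ℂ) • b j := by
  have h : NormedSpace.exp (-((2 : ℂ) • H)) (b j) = ((Real.exp (-(2 * l j)) : ℝ) : ℂ) • b j :=
    exp_apply_of_eigenvector (by rw [neg_apply, smul_apply, hH]; push_cast; module)
  have h2 : Real.exp (-l j) ^ 2 = Real.exp (-(2 * l j)) := by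
    rw [← Real.exp_nat_mul]
    congr 1
    push_cast
    ring
  rw [mul_apply_eq_comp, hT, map_smul, sub_apply, h, h2, one_apply_eq_self]
  push_cast
  module

end Exponential

/-! ### Compatible pairs -/

section Compatible

variable {E : Type*} [NormedAddCommGroup E] [InnerProductSpace ℂ E] [FiniteDimensional ℂ E]
  [CompleteSpace E]
variable {ι : Type*} [Fintype ι] {b : OrthonormalBasis ι ℂ E} {S R T : E →L[ℂ] E} {s μ : ι → ℝ}

theorem isCompatiblePair_of_apply_basis (hS : ∀ j, S (b j) = (s j : ℂ) • b j)
    (hT : ∀ j, T (b j) = (μ j : ℂ) • b j)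
    (hR : ∀ j, R (b j) = (((1 - s j ^ 2) * μ j : ℝ) : ℂ) • b j)
    (hs0 : ∀ j, 0 ≤ s j) (hs1 : ∀ j, s j ≤ 1) (hT0 : 0 ≤ T) (hT1 : T ≤ 1) :
    IsCompatiblePair S R := by
  have hμ0 := (nonneg_iff_of_apply_basis hT).1 hT0
  have hsub : ∀ {A B : E →L[ℂ] E} {x y : ι → ℝ}, (∀ j, A (b j) = (x j : ℂ) • b j) →
      (∀ j, B (b j) = (y j : ℂ) • b j) → ∀ j, (B - A) (b j) = ((y j - x j : ℝ) : ℂ) • b j := by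
    intro A B x y hA hB j
    rw [sub_apply, hA, hB]
    push_cast
    module
  have hone : ∀ j, (1 : E →L[ℂ] E) (b j) = ((1 : ℝ) : ℂ) • b j := fun j => by simp
  have hμ1 := (nonneg_iff_of_apply_basis (hsub hT hone)).1 (sub_nonneg.2 hT1)
  have hsq : ∀ j, s j ^ 2 ≤ 1 := fun j => pow_le_one₀ (hs0 j) (hs1 j)
  refine ⟨?_, ?_, ?_, ?_⟩
  · rw [CStarAlgebra.norm_le_one_iff_of_nonneg S ((nonneg_iff_of_apply_basis hS).2 hs0),
      ← sub_nonneg, nonneg_iff_of_apply_basis (hsub hS hone)]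
    exact fun j => sub_nonneg.2 (hs1 j)
  · rw [nonneg_iff_of_apply_basis hR]
    exact fun j => mul_nonneg (sub_nonneg.2 (hsq j)) (hμ0 j)
  · rw [← sub_nonneg, nonneg_iff_of_apply_basis (hsub hR hone)]
    intro j
    nlinarith [hμ0 j, hμ1 j, hsq j, sq_nonneg (s j)]
  · rw [← sub_nonneg, nonneg_iff_of_apply_basis (hsub hR (defect_apply_basis hS))]
    intro j
    nlinarith [hμ0 j, hμ1 j, hsq j, sq_nonneg (s j)]

/-- For uniqueness let D = T' - T, so CDC = 0 with C diagonal with entries c_j. Then c_i c_j D_ij =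
0, and an index with c_j = 0 lies in the kernel of 1 - SS*, where D vanishes; self-adjointness of D
treats rows like columns. -/
theorem isAncillaSymbol_iff_of_apply_basis (hS : ∀ j, S (b j) = (s j : ℂ) • b j)
    (hT : ∀ j, T (b j) = (μ j : ℂ) • b j)
    (hR : ∀ j, R (b j) = (((1 - s j ^ 2) * μ j : ℝ) : ℂ) • b j)
    (hs : ∀ j, s j ^ 2 ≤ 1) (hT0 : 0 ≤ T) (hT1 : T ≤ 1)
    (hker : ∀ ψ, (1 - S * star S) ψ = 0 → T ψ = 0) (T' : E →L[ℂ] E) :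
    IsAncillaSymbol S R T' ↔ T' = T := by
  have hC := sqrt_defect_apply_basis hS hs
  set C := CFC.sqrt (1 - S * star S) with hCdef
  have hRT : R = C * T * C := ext_orthonormalBasis b fun j => by
    rw [mul_apply_eq_comp, mul_apply_eq_comp, hC, map_smul, hT, map_smul, map_smul, hC, hR,
      smul_smul, smul_smul, mul_right_comm, ← Complex.ofReal_mul, ← Complex.ofReal_mul,
      Real.mul_self_sqrt (sub_nonneg.2 (hs j))]
  constructor
  · rintro ⟨hT0', -, hker', hR'⟩
    have hz : C * (T' - T) * C = 0 := by
      rw [mul_sub, sub_mul, ← hR', ← hRT, sub_self]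
    have hCs : IsSelfAdjoint C := star_eq_self_of_apply_basis hC
    have hDs : IsSelfAdjoint (T' - T) :=
      (IsSelfAdjoint.of_nonneg hT0').sub (IsSelfAdjoint.of_nonneg hT0)
    have hDsymm := hDs.isSymmetric
    have hCsymm := hCs.isSymmetric
    have hzero : ∀ j, √(1 - s j ^ 2) = 0 → (T' - T) (b j) = 0 := fun j hj => by
      have h0 : (1 - S * star S) (b j) = 0 := by
        rw [defect_apply_basis hS, (Real.sqrt_eq_zero (sub_nonneg.2 (hs j))).1 hj]
        simp
      rw [sub_apply, hker' _ h0, hker _ h0, sub_self]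
    rw [← sub_eq_zero]
    refine ext_orthonormalBasis b fun j => InnerProductSpace.ext_inner_left_basis b.toBasis
      fun i => ?_
    rw [b.coe_toBasis, zero_apply, inner_zero_right]
    by_cases hj : √(1 - s j ^ 2) = 0
    · rw [hzero j hj, inner_zero_right]
    by_cases hi : √(1 - s i ^ 2) = 0
    · have := hDsymm (b i) (b j)
      simp only [ContinuousLinearMap.coe_coe] at this
      rw [← this, hzero i hi, inner_zero_left]
    have h1 : inner ℂ (b i) ((C * (T' - T) * C) (b j)) = 0 := by
      rw [hz, zero_apply, inner_zero_right]
    have h2 := hCsymm (b i) ((T' - T) (C (b j)))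
    simp only [ContinuousLinearMap.coe_coe] at h2
    rw [mul_apply_eq_comp, mul_apply_eq_comp, ← h2, hC, hC, map_smul, inner_smul_left,
      inner_smul_right, Complex.conj_ofReal] at h1
    have hi' : ((√(1 - s i ^ 2) : ℝ) : ℂ) ≠ 0 := Complex.ofReal_ne_zero.2 hi
    have hj' : ((√(1 - s j ^ 2) : ℝ) : ℂ) ≠ 0 := Complex.ofReal_ne_zero.2 hj
    exact (mul_eq_zero.1 ((mul_eq_zero.1 h1).resolve_left hi')).resolve_left hj'
  · rintro rfl
    exact ⟨hT0, hT1, hker, hRT⟩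

omit [FiniteDimensional ℂ E] in
theorem ancillaSymbol_eq (h : ∀ T', IsAncillaSymbol S R T' ↔ T' = T) : ancillaSymbol S R = T := by
  have hex : ∃ T, IsAncillaSymbol S R T := ⟨T, (h T).2 rfl⟩
  rw [ancillaSymbol, dif_pos hex]
  exact (h _).1 hex.choose_spec

end Compatible

/-! ### The action of the map on the Hermite operators -/

section Action

variable {E : Type*} [NormedAddCommGroup E] [InnerProductSpace ℂ E] [FiniteDimensional ℂ E]
  [CompleteSpace E]
variable {K : Type*} [NormedAddCommGroup K] [InnerProductSpace ℂ K] [FiniteDimensional ℂ K]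
variable {Z : E →ₗ⋆[ℂ] Module.End ℂ K} {N : ℕ} {ψ : OrthonormalBasis (Fin N) ℂ E}
  {S R T : E →L[ℂ] E} {s μ : Fin N → ℝ}

theorem tau_star_modeProd_mul_ehkMap [Nontrivial K] (hZ : IsCAR Z) (htop : carAlgebra Z = ⊤)
    (hS : ∀ j, S (ψ j) = (s j : ℂ) • ψ j) (hs : ∀ j, s j ^ 2 ≤ 1)
    (hT : ∀ j, T (ψ j) = (μ j : ℂ) • ψ j) (hanc : ancillaSymbol S R = T)
    (α : Fin N → Fin 2 × Fin 2) (X : Module.End ℂ K) :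
    tau (star (modeProd (fun j => Z (ψ j)) μ α) * ehkMap Z S R X) =
      ((∏ j, s j ^ (((α j).1 : ℕ) + ((α j).2 : ℕ)) : ℝ) : ℂ) *
        tau (star (modeProd (fun j => Z (ψ j)) μ α) * X) := by
  obtain ⟨hρ, hρs, hρ1⟩ := hZ.gigDensity_spec (T := T) (star_eq_self_of_apply_basis hT)
  obtain ⟨f, hf, hf'⟩ := exists_dilation_hom hZ htop (inner_dilation hS hs)
  rw [tau_star_mul_ehkMap hZ htop f hf' (hanc ▸ hρ.even), hanc, map_modeProd, map_modeProd]
  have hC := sqrt_defect_apply_basis hS hs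
  have hmode : ∀ j, f (embedA hZ (Z (ψ j))) = dilatedMode Z (ψ j) (√(1 - s j ^ 2)) (s j) := by
    intro j
    have e : dilation S (WithLp.toLp 2 (ψ j, 0)) = WithLp.toLp 2
        (-(((√(1 - s j ^ 2) : ℝ) : ℂ) • ψ j), (s j : ℂ) • ψ j) := by
      refine congrArg (WithLp.toLp 2) (Prod.ext ?_ ?_)
      · change -(CFC.sqrt (1 - S * star S) (ψ j)) + S 0 = _
        rw [hC, map_zero, add_zero]
      · change star S (ψ j) + CFC.sqrt (1 - star S * S) 0 = _
        rw [star_eq_self_of_apply_basis hS, hS, map_zero, add_zero]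
    rw [embedA_field, squareFieldA, hf, e, squareField_eq, dilatedMode]
    change kron (Z (-(((√(1 - s j ^ 2) : ℝ) : ℂ) • ψ j))) _ + kron 1 (Z ((s j : ℂ) • ψ j)) = _
    simp only [map_neg, map_smulₛₗ, Complex.conj_ofReal, neg_kron, smul_kron, kron_smul]
    abel
  simp only [hmode]
  -- The factorization is applied to the adjoint of `X` and then conjugated, since the pairing has
  -- the star on the Hermite side; the scaling factors are real.
  have key := hρ.tau_modeProd_dilatedMode hZ hρ1 ψ.orthonormal hT
    (c := fun j => √(1 - s j ^ 2)) (s := s)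
    (fun j => by rw [Real.sq_sqrt (sub_nonneg.2 (hs j))]; ring) α (star X)
  have key2 := congrArg star key
  rw [star_mul', ← tau_star, ← tau_star, star_mul, star_mul, star_kron, star_star, hρs,
    tau_mul_comm, Complex.star_def, Complex.conj_ofReal] at key2
  rw [key2, tau_mul_comm X]

theorem hsAdjoint_ehkMap_modeProd [Nontrivial K] (hZ : IsCAR Z) (htop : carAlgebra Z = ⊤)
    (hS : ∀ j, S (ψ j) = (s j : ℂ) • ψ j) (hs : ∀ j, s j ^ 2 ≤ 1)
    (hT : ∀ j, T (ψ j) = (μ j : ℂ) • ψ j) (hanc : ancillaSymbol S R = T)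
    (α : Fin N → Fin 2 × Fin 2) :
    hsAdjoint (ehkMap Z S R) (modeProd (fun j => Z (ψ j)) μ α) =
      ((∏ j, s j ^ (((α j).1 : ℕ) + ((α j).2 : ℕ)) : ℝ) : ℂ) •
        modeProd (fun j => Z (ψ j)) μ α := by
  refine star_injective (eq_of_tau_mul_eq fun X => ?_)
  rw [tau_mul_comm, hsAdjoint_spec, tau_star_modeProd_mul_ehkMap hZ htop hS hs hT hanc, star_smul,
    mul_smul_comm, tau_smul, Complex.star_def, Complex.conj_ofReal, tau_mul_comm]

/-- The adjoint is diagonal with real eigenvalues in a spanning family that is orthogonal for the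
GNS form; by sesquilinearity the symmetry need only be checked on that family. -/
theorem gnsInner_hsAdjoint_ehkMap [Nontrivial K] (hZ : IsCAR Z) (htop : carAlgebra Z = ⊤)
    (hS : ∀ j, S (ψ j) = (s j : ℂ) • ψ j) (hs : ∀ j, s j ^ 2 ≤ 1)
    (hT : ∀ j, T (ψ j) = (μ j : ℂ) • ψ j) (hanc : ancillaSymbol S R = T)
    (X Y : Module.End ℂ K) :
    gnsInner (gigDensity Z T) X (hsAdjoint (ehkMap Z S R) Y) =
      gnsInner (gigDensity Z T) (hsAdjoint (ehkMap Z S R) X) Y := by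
  obtain ⟨hρ, -, -⟩ := hZ.gigDensity_spec (T := T) (star_eq_self_of_apply_basis hT)
  set ρ := gigDensity Z T
  set Ψ := hsAdjoint (ehkMap Z S R)
  have hΨ := hsAdjoint_ehkMap_modeProd hZ htop hS hs hT hanc
  have hspan : ∀ X, X ∈ Submodule.span ℂ (Set.range (modeProd (fun j => Z (ψ j)) μ)) := fun X => by
    rw [span_modeProd_eq_top hZ htop]
    exact trivial
  simp only [gnsInner]
  induction hspan X using Submodule.span_induction with
  | zero => simp [tau_zero]
  | add X X' _ _ hX hX' =>
    simp only [map_add, star_add, add_mul, tau_add, hX, hX']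
  | smul c X _ hX => simp only [map_smul, star_smul, smul_mul_assoc, tau_smul, hX]
  | mem X hX =>
    obtain ⟨α, rfl⟩ := hX
    induction hspan Y using Submodule.span_induction with
    | zero => simp [tau_zero]
    | add Y Y' _ _ hY hY' => simp only [map_add, mul_add, add_mul, tau_add, hY, hY']
    | smul c Y _ hY => simp only [map_smul, mul_smul_comm, smul_mul_assoc, tau_smul, hY]
    | mem Y hY =>
      obtain ⟨β, rfl⟩ := hY
      rw [hΨ, hΨ, star_smul, mul_smul_comm, smul_mul_assoc, smul_mul_assoc, smul_mul_assoc,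
        tau_smul, tau_smul, Complex.star_def, Complex.conj_ofReal]
      rcases eq_or_ne α β with rfl | h
      · rfl
      · rw [hρ.tau_star_modeProd_mul hZ ψ.orthonormal hT h, mul_zero, mul_zero]

/-- Symmetry gives τ(X Φ†(Y)ρ) = τ(Φ†(X*)* Yρ) = τ(X Φ(Yρ)) for all X, and the trace separates
operators. No invertibility of ρ enters. -/
theorem ehkMap_mul_of_gnsInner {Φ : Module.End ℂ K →ₗ[ℂ] Module.End ℂ K} {ρ : Module.End ℂ K}
    (h : ∀ X Y, gnsInner ρ X (hsAdjoint Φ Y) = gnsInner ρ (hsAdjoint Φ X) Y)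
    (Y : Module.End ℂ K) : Φ (Y * ρ) = hsAdjoint Φ Y * ρ := by
  refine eq_of_tau_mul_eq fun X => ?_
  have h1 := h (star X) Y
  have h2 := hsAdjoint_spec Φ (star X) (Y * ρ)
  rw [star_star] at h2
  rw [gnsInner, gnsInner, star_star, mul_assoc, mul_assoc] at h1
  rw [← h2, ← h1]

end Action

end Fermion

end

theorem theorem3p9
    {E : Type*} [NormedAddCommGroup E] [InnerProductSpace ℂ E] [FiniteDimensional ℂ E]
    [CompleteSpace E]
    {K : Type*} [NormedAddCommGroup K] [InnerProductSpace ℂ K] [FiniteDimensional ℂ K]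
    (Z : E →ₗ⋆[ℂ] Module.End ℂ K) (hZ : Fermion.IsIrreducibleCARField Z)
    (T H : E →L[ℂ] E) (hT0 : 0 ≤ T) (hT1 : T ≤ 1) (hH : 0 ≤ H) (hHT : Commute H T)
    (hker : ∀ ψ : E, H ψ = 0 → T ψ = 0)
    (S R : E →L[ℂ] E) (hS : S = NormedSpace.exp (-H))
    (hR : R = (1 - NormedSpace.exp (-((2 : ℂ) • H))) * T) :
    Fermion.IsCompatiblePair S R ∧
    (∀ T' : E →L[ℂ] E, Fermion.IsAncillaSymbol S R T' ↔ T' = T) ∧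
    (∀ (N : ℕ) (ψ : OrthonormalBasis (Fin N) ℂ E) (l μ : Fin N → ℝ),
      (∀ j, H (ψ j) = (l j : ℂ) • ψ j) → (∀ j, T (ψ j) = (μ j : ℂ) • ψ j) →
      LinearIndependent ℂ (Fermion.hermite Z ψ μ) ∧
      Submodule.span ℂ (Set.range (Fermion.hermite Z ψ μ)) = ⊤ ∧
      (∀ α : Fin N → Fin 2 × Fin 2,
        Fermion.hsAdjoint (Fermion.ehkMap Z S R) (Fermion.hermite Z ψ μ α) =
          ((Real.exp (-∑ j, Fermion.degree (α j) * l j) : ℝ) : ℂ) •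
            Fermion.hermite Z ψ μ α) ∧
      (∀ α : Fin N → Fin 2 × Fin 2,
        Fermion.ehkMap Z S R (Fermion.hermite Z ψ μ α * Fermion.gigDensity Z T) =
          ((Real.exp (-∑ j, Fermion.degree (α j) * l j) : ℝ) : ℂ) •
            (Fermion.hermite Z ψ μ α * Fermion.gigDensity Z T))) ∧
    (∀ X Y : Module.End ℂ K,
      Fermion.gnsInner (Fermion.gigDensity Z T) X
          (Fermion.hsAdjoint (Fermion.ehkMap Z S R) Y) =
        Fermion.gnsInner (Fermion.gigDensity Z T)
          (Fermion.hsAdjoint (Fermion.ehkMap Z S R) X) Y) := by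
  have hK := hZ.nontrivial
  have htop := hZ.carAlgebra_eq_top
  have hcar := hZ.isCAR
  -- An auxiliary basis for the basis-free claims. Their conclusions, the ancilla symbol and GNS
  -- symmetry, are reused below for an arbitrary joint eigenbasis.
  obtain ⟨n, b, l, μ, hHb, hTb⟩ := Fermion.exists_joint_eigenbasis
    (IsSelfAdjoint.of_nonneg hH).isSymmetric (IsSelfAdjoint.of_nonneg hT0).isSymmetric
    (congrArg (fun A : E →L[ℂ] E => (A : E →ₗ[ℂ] E)) hHT.eq)
  have hHb' : ∀ j, H (b j) = (l j : ℂ) • b j := hHb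
  have hTb' : ∀ j, T (b j) = (μ j : ℂ) • b j := hTb
  have hl := (Fermion.nonneg_iff_of_apply_basis hHb').1 hH
  have hSb : ∀ {N : ℕ} {ψ : OrthonormalBasis (Fin N) ℂ E} {l : Fin N → ℝ},
      (∀ j, H (ψ j) = (l j : ℂ) • ψ j) → ∀ j, S (ψ j) = ((Real.exp (-l j) : ℝ) : ℂ) • ψ j :=
    fun h j => hS ▸ Fermion.exp_neg_apply_basis h j
  have hs1 : ∀ {N : ℕ} {ψ : OrthonormalBasis (Fin N) ℂ E} {l : Fin N → ℝ},
      (∀ j, H (ψ j) = (l j : ℂ) • ψ j) → ∀ j, Real.exp (-l j) ≤ 1 := fun h j => by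
    have := (Fermion.nonneg_iff_of_apply_basis h).1 hH j
    rw [Real.exp_le_one_iff]
    linarith
  have hs2 : ∀ {N : ℕ} {ψ : OrthonormalBasis (Fin N) ℂ E} {l : Fin N → ℝ},
      (∀ j, H (ψ j) = (l j : ℂ) • ψ j) → ∀ j, Real.exp (-l j) ^ 2 ≤ 1 := fun h j =>
    pow_le_one₀ (Real.exp_pos _).le (hs1 h j)
  have hRb := fun j => hR ▸ Fermion.one_sub_exp_mul_apply_basis hHb' hTb' j
  have hker' : ∀ ψ : E, (1 - S * star S) ψ = 0 → T ψ = 0 := by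
    intro φ hφ
    refine hker φ ?_
    have hsum := b.sum_repr' φ
    -- A vector killed by 1 - SS* has components only along those `b j` with e^{-2λ_j} = 1, that is
    -- λ_j = 0; hence it lies in the kernel of `H`.
    have h0 : ∀ j, ((1 - Real.exp (-l j) ^ 2 : ℝ) : ℂ) * inner ℂ (b j) φ = 0 := fun j => by
      have hD : star (1 - S * star S) = 1 - S * star S := by simp
      have := congrArg (fun x => inner ℂ (b j) x) hφ
      simp only [inner_zero_right] at this
      rw [← hD, ContinuousLinearMap.star_eq_adjoint, ContinuousLinearMap.adjoint_inner_right,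
        Fermion.defect_apply_basis (hSb hHb'), inner_smul_left, Complex.conj_ofReal] at this
      exact this
    rw [← hsum, map_sum]
    refine Finset.sum_eq_zero fun j _ => ?_
    rw [map_smul, hHb', smul_smul]
    rcases mul_eq_zero.1 (h0 j) with h | h
    · have h1 : 1 - Real.exp (-l j) ^ 2 = 0 := Complex.ofReal_eq_zero.1 h
      have h2 : Real.exp (-l j) = 1 := by nlinarith [Real.exp_pos (-l j)]
      have h3 : l j = 0 := by
        rw [Real.exp_eq_one_iff] at h2
        linarith
      rw [h3, Complex.ofReal_zero, mul_zero, zero_smul]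
    · rw [h, zero_mul, zero_smul]
  have hanc := Fermion.isAncillaSymbol_iff_of_apply_basis (hSb hHb') hTb' hRb (hs2 hHb') hT0 hT1
    hker'
  have hanc' := Fermion.ancillaSymbol_eq hanc
  have hgns := Fermion.gnsInner_hsAdjoint_ehkMap hcar htop (hSb hHb') (hs2 hHb') hTb' hanc'
  refine ⟨Fermion.isCompatiblePair_of_apply_basis (hSb hHb') hTb' hRb
    (fun j => (Real.exp_pos _).le) (hs1 hHb') hT0 hT1, hanc, fun N ψ l μ hHψ hTψ => ?_, hgns⟩
  have hherm : Fermion.hermite Z ψ μ = Fermion.modeProd (fun j => Z (ψ j)) μ :=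
    funext fun α => Fermion.hermite_eq_modeProd Z ψ μ α
  have hexp : ∀ α : Fin N → Fin 2 × Fin 2,
      ∏ j, Real.exp (-l j) ^ (((α j).1 : ℕ) + ((α j).2 : ℕ)) =
        Real.exp (-∑ j, Fermion.degree (α j) * l j) := fun α => by
    rw [← Finset.sum_neg_distrib, Real.exp_sum]
    refine Finset.prod_congr rfl fun j _ => ?_
    rw [← Real.exp_nat_mul, Fermion.degree]
    congr 1
    push_cast
    ring
  have hadj : ∀ α : Fin N → Fin 2 × Fin 2,
      Fermion.hsAdjoint (Fermion.ehkMap Z S R) (Fermion.hermite Z ψ μ α) =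
        ((Real.exp (-∑ j, Fermion.degree (α j) * l j) : ℝ) : ℂ) • Fermion.hermite Z ψ μ α :=
    fun α => by
      rw [hherm, Fermion.hsAdjoint_ehkMap_modeProd hcar htop (hSb hHψ) (hs2 hHψ) hTψ hanc', hexp]
  refine ⟨hherm ▸ Fermion.linearIndependent_modeProd hcar htop ψ μ,
    hherm ▸ Fermion.span_modeProd_eq_top hcar htop ψ μ, hadj, fun α => ?_⟩
  rw [Fermion.ehkMap_mul_of_gnsInner hgns, hadj, smul_mul_assoc]
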